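/- All manifolds are smooth real Banach manifolds without boundary. Let $(M,\omega)$ be a pre-symplectic manifold: $\omega$ is a smooth closed $2$-form on $M$ whose kernels $K_m=\ker\omega_m\subseteq T_mM$ form a smooth vector subbundle $K\subseteq TM$ with typical fibre $F$. Let $\tau:K^*\to M$ be the dual bundle of $K$, and let $P:TM\to K$ be a connection, i.e. a smooth bundle map with $P|_K=\mathrm{id}_K$; vector fields $X$ with $P(X)=0$ are called horizontal, and every vector field splits as $X=X_V+X_H$ with $X_V=P(X)$, $X_H=X-P(X)$. Define a $1$-form on $K^*$ by $\vartheta^P_\mu(\xi)=\mu\big(P(T\tau\,\xi)\big)$, and let $\tilde M\subseteq K^*$ be an open neighbourhood of the zero section on which $$\tilde\omega=\tau^*\omega+d\vartheta^P$$ is (weakly) nondegenerate; $(\tilde M,\tilde\omega)$ is the symplectic thickening of $(M,\omega)$. Assume that $P$ is flat: the Lie bracket of any two (locally defined) horizontal vector fields is horizontal. Call a smooth local frame of $K$ (a smooth family of isomorphisms $e_m:F\to K_m$, $m\in O$, with $O\subseteq M$ open) adapted to $P$ if $P([X,e v])=0$ for every $v\in F$ and every local horizontal vector field $X$ on an open subset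 of $O$; its linear fibre coordinates are the functions $\mu\mapsto\mu_v:=\mu(e_{\tau(\mu)}v)$, $v\in F$, on $\tau^{-1}(O)$. Let $\Gamma$ be a smooth vector field on $M$ with $i_\Gamma\omega=dH$ for some $H\in C^\infty(M)$. Let $\tilde\Gamma=\tilde\Gamma_V+\tilde\Gamma_H$, where $\tilde\Gamma_V,\tilde\Gamma_H$ are smooth vector fields on $\tilde M$ such that - $T\tau(\tilde\Gamma_V)=\Gamma_V$ and $\mathcal L_{\tilde\Gamma_V}\vartheta^P=0$; - $T\tau(\tilde\Gamma_H)=\Gamma_H$, and around every point of $\tilde M$ the fibre coordinates of some adapted local frame are held constant by $\tilde\Gamma_H$: $d\mu_v(\tilde\Gamma_H)=0$ for all $v\in F$. Then $\mathcal L_{\tilde\Gamma}\tilde\omega=0$ on $\tilde M$. -/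

import Mathlib

open Set Bundle
open scoped Manifold ContDiff Topology

noncomputable section

/-! ### Differential forms on (Banach) manifolds without boundary -/

section Forms

variable {E : Type*} [NormedAddCommGroup E] [NormedSpace ℝ E]
  {H : Type*} [TopologicalSpace H] (I : ModelWithCorners ℝ E H)
  {M : Type*} [TopologicalSpace M] [ChartedSpace H M]

variable (M) in
/-- A (not necessarily smooth) differential `k`-form on `M`. -/
abbrev DForm (k : ℕ) : Type _ := ∀ p : M, TangentSpace I p [⋀^Fin k]→L[ℝ] ℝ

variable {I}

/-- The local representative of the form `η` in the preferred chart `φ` at `p`: the pull-back of `η`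
under `φ⁻¹`, a form on the model space (meaningful on the target of `φ`). -/
def DForm.chartRep {k : ℕ} (η : DForm I M k) (p : M) (x : E) : E [⋀^Fin k]→L[ℝ] ℝ :=
  (η ((extChartAt I p).symm x)).compContinuousLinearMap
    ((mfderiv 𝓘(ℝ, E) I (extChartAt I p).symm x) ∘L
      (NormedSpace.fromTangentSpace (𝕜 := ℝ) x).symm.toContinuousLinearMap)

/-- Smoothness of a form: all local representatives are smooth. -/
def DForm.IsSmooth {k : ℕ} (η : DForm I M k) : Prop :=
  ∀ p : M, ContDiffOn ℝ ∞ (η.chartRep p) (extChartAt I p).target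

/-- The exterior derivative, computed at `p` in the preferred chart at `p`
(for manifolds without boundary). -/
def DForm.d {k : ℕ} (η : DForm I M k) : DForm I M (k + 1) := fun p =>
  (extDeriv (η.chartRep p) (extChartAt I p p)).compContinuousLinearMap
    ((NormedSpace.fromTangentSpace (𝕜 := ℝ) (extChartAt I p p)).toContinuousLinearMap ∘L
      (mfderiv I 𝓘(ℝ, E) (extChartAt I p) p))

/-- The contraction `i_Z η` of a form with a vector field. -/
def DForm.interior {k : ℕ} (Z : ∀ p : M, TangentSpace I p) (η : DForm I M (k + 1)) :
    DForm I M k := fun p =>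
  { (η p).toAlternatingMap.curryLeft (Z p) with
    cont := (η p).cont.comp (continuous_const.finCons continuous_id) }

/-- The Lie derivative `L_Z η = d (i_Z η) + i_Z (d η)` of a form of positive degree. -/
def DForm.lie {k : ℕ} (Z : ∀ p : M, TangentSpace I p) (η : DForm I M (k + 1)) :
    DForm I M (k + 1) :=
  (η.interior Z).d + (η.d).interior Z

/-- The `1`-form with values `α p`. -/
def DForm.ofOneForm (α : ∀ p : M, TangentSpace I p →L[ℝ] ℝ) : DForm I M 1 := fun p =>
  ContinuousAlternatingMap.ofSubsingleton ℝ (TangentSpace I p) ℝ (0 : Fin 1) (α p)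

/-- The pull-back `f^* η`. -/
def DForm.pullback {E' : Type*} [NormedAddCommGroup E'] [NormedSpace ℝ E']
    {H' : Type*} [TopologicalSpace H'] {I' : ModelWithCorners ℝ E' H'}
    {N : Type*} [TopologicalSpace N] [ChartedSpace H' N] {k : ℕ}
    (f : N → M) (η : DForm I M k) : DForm I' N k := fun q =>
  (η (f q)).compContinuousLinearMap (mfderiv I' I f q)

/-- The characteristic subspace `K_m = ker Ω_m` of a `2`-form. -/
def DForm.ker (Ω : DForm I M 2) (m : M) : Submodule ℝ (TangentSpace I m) where
  carrier := {v | ∀ w, Ω m ![v, w] = 0}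
  zero_mem' w := (Ω m).map_coord_zero 0 rfl
  add_mem' {a b} ha hb w := by
    have h := (Ω m).toMultilinearMap.cons_add ![w] a b
    exact h.trans (by erw [ha w, hb w]; exact add_zero 0)
  smul_mem' c a ha w := by
    have h := (Ω m).toMultilinearMap.cons_smul ![w] c a
    exact h.trans (by erw [ha w]; exact smul_zero c)

/-- Smoothness of a vector field on the set `s`. -/
def SmoothFieldOn [IsManifold I ∞ M] (X : ∀ p : M, TangentSpace I p) (s : Set M) : Prop :=
  ContMDiffOn I I.tangent ∞ (fun p => (⟨p, X p⟩ : TangentBundle I M)) s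

end Forms

/-! ### The characteristic bundle, its dual, and connections -/

section Thickening

variable {E : Type*} [NormedAddCommGroup E] [NormedSpace ℝ E]
  {M : Type*} [TopologicalSpace M] [ChartedSpace E M]

/-- The fibre `K_m = ker Ω_m` of the characteristic bundle. -/
abbrev CharFiber (Ω : DForm 𝓘(ℝ, E) M 2) (m : M) : Type _ := Ω.ker m

/-- The fibre `K_m^*` of the dual of the characteristic bundle. -/
abbrev CharDual (Ω : DForm 𝓘(ℝ, E) M 2) (m : M) : Type _ := CharFiber Ω m →L[ℝ] Trivial M ℝ m

variable (F : Type*) [NormedAddCommGroup F] [NormedSpace ℝ F]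
  (Ω : DForm 𝓘(ℝ, E) M 2)
  [TopologicalSpace (TotalSpace F (CharFiber Ω))]
  [FiberBundle F (CharFiber Ω)] [VectorBundle ℝ F (CharFiber Ω)]

/-- The total space `K^*` of the dual bundle. -/
abbrev DualTotal : Type _ := TotalSpace (F →L[ℝ] ℝ) (CharDual Ω)

/-- The model with corners of `K^*`. -/
abbrev dualModel (E F : Type*) [NormedAddCommGroup E] [NormedSpace ℝ E]
    [NormedAddCommGroup F] [NormedSpace ℝ F] :
    ModelWithCorners ℝ (E × (F →L[ℝ] ℝ)) (ModelProd E (F →L[ℝ] ℝ)) :=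
  𝓘(ℝ, E).prod 𝓘(ℝ, F →L[ℝ] ℝ)

/-- The bundle structure chosen on `K = ker Ω` is that of a smooth subbundle of `TM`:
the inclusion `K → TM` is smooth. -/
def IsCharBundle [IsManifold 𝓘(ℝ, E) ∞ M] : Prop :=
  ContMDiff (𝓘(ℝ, E).prod 𝓘(ℝ, F)) 𝓘(ℝ, E).tangent ∞
    (fun k : TotalSpace F (CharFiber Ω) =>
      (⟨k.proj, (k.snd : TangentSpace 𝓘(ℝ, E) k.proj)⟩ : TangentBundle 𝓘(ℝ, E) M))

/-- A connection: a smooth bundle map `P : TM → K` restricting to the identity on `K`. -/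
structure IsConnection [IsManifold 𝓘(ℝ, E) ∞ M]
    (P : ∀ m : M, TangentSpace 𝓘(ℝ, E) m →L[ℝ] CharFiber Ω m) : Prop where
  smooth : ContMDiff 𝓘(ℝ, E).tangent (𝓘(ℝ, E).prod 𝓘(ℝ, F)) ∞
    (fun v : TangentBundle 𝓘(ℝ, E) M =>
      (⟨v.proj, P v.proj v.snd⟩ : TotalSpace F (CharFiber Ω)))
  proj : ∀ (m : M) (k : CharFiber Ω m), P m (k : TangentSpace 𝓘(ℝ, E) m) = k

end Thickening

section Lift

variable {E : Type*} [NormedAddCommGroup E] [NormedSpace ℝ E]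
  {M : Type*} [TopologicalSpace M] [ChartedSpace E M]
  {Ω : DForm 𝓘(ℝ, E) M 2}

/-- The vertical part `X_V = P X` of a vector field. -/
def vertPart (P : ∀ m : M, TangentSpace 𝓘(ℝ, E) m →L[ℝ] CharFiber Ω m)
    (X : ∀ m : M, TangentSpace 𝓘(ℝ, E) m) (m : M) : TangentSpace 𝓘(ℝ, E) m :=
  (P m (X m) : CharFiber Ω m)

/-- The horizontal part `X_H = X - P X` of a vector field. -/
def horPart (P : ∀ m : M, TangentSpace 𝓘(ℝ, E) m →L[ℝ] CharFiber Ω m)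
    (X : ∀ m : M, TangentSpace 𝓘(ℝ, E) m) (m : M) : TangentSpace 𝓘(ℝ, E) m :=
  X m - vertPart P X m

/-- `X` is a smooth horizontal vector field on the set `O`. -/
def IsHorizontalOn [IsManifold 𝓘(ℝ, E) ∞ M]
    (P : ∀ m : M, TangentSpace 𝓘(ℝ, E) m →L[ℝ] CharFiber Ω m)
    (X : ∀ m : M, TangentSpace 𝓘(ℝ, E) m) (O : Set M) : Prop :=
  SmoothFieldOn X O ∧ ∀ m ∈ O, P m (X m) = 0

/-- Flatness: the bracket of two (locally defined) horizontal vector fields is horizontal. -/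
def IsFlat [IsManifold 𝓘(ℝ, E) ∞ M]
    (P : ∀ m : M, TangentSpace 𝓘(ℝ, E) m →L[ℝ] CharFiber Ω m) : Prop :=
  ∀ (O : Set M), IsOpen O → ∀ X Y : (∀ m : M, TangentSpace 𝓘(ℝ, E) m),
    IsHorizontalOn P X O → IsHorizontalOn P Y O →
      ∀ m ∈ O, P m (VectorField.mlieBracket 𝓘(ℝ, E) X Y m) = 0

variable {F : Type*} [NormedAddCommGroup F] [NormedSpace ℝ F]
  [TopologicalSpace (TotalSpace F (CharFiber Ω))]
  [FiberBundle F (CharFiber Ω)] [VectorBundle ℝ F (CharFiber Ω)]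

/-- A smooth local frame of `K` over `O` (given as an `F`-valued frame `e_m : F ≃ K_m`) adapted
to `P`: each of its sections `V = e v` satisfies `P [X, V] = 0` for every local horizontal field
`X`, that is, the frame is invariant along the horizontal directions. The values of `e` off `O`
are irrelevant. -/
structure IsAdaptedFrame [IsManifold 𝓘(ℝ, E) ∞ M]
    (P : ∀ m : M, TangentSpace 𝓘(ℝ, E) m →L[ℝ] CharFiber Ω m)
    (O : Set M) (e : ∀ m : M, F ≃L[ℝ] CharFiber Ω m) : Prop where
  smooth : ContMDiffOn (𝓘(ℝ, E).prod 𝓘(ℝ, F)) (𝓘(ℝ, E).prod 𝓘(ℝ, F)) ∞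
    (fun x : M × F => (⟨x.1, e x.1 x.2⟩ : TotalSpace F (CharFiber Ω))) (O ×ˢ univ)
  invariant : ∀ (v : F) (O' : Set M), IsOpen O' → O' ⊆ O →
    ∀ X : (∀ m : M, TangentSpace 𝓘(ℝ, E) m), IsHorizontalOn P X O' →
      ∀ m ∈ O', P m (VectorField.mlieBracket 𝓘(ℝ, E) X
        (fun m' => ((e m' v : CharFiber Ω m') : TangentSpace 𝓘(ℝ, E) m')) m) = 0

/-- The linear fibre coordinate `μ ↦ μ (e v)` on `K^*` given by a frame `e` and `v : F`. -/
def fibreCoord (e : ∀ m : M, F ≃L[ℝ] CharFiber Ω m) (v : F) (μ : DualTotal F Ω) : ℝ :=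
  μ.snd (e μ.proj v)

/-- The tangent map `Tτ` of the projection `τ : K^* → M`. -/
def tangentProj (μ : DualTotal F Ω) :
    TangentSpace (dualModel E F) μ →L[ℝ] TangentSpace 𝓘(ℝ, E) μ.proj :=
  mfderiv (dualModel E F) 𝓘(ℝ, E) (fun ν : DualTotal F Ω => ν.proj) μ

/-- The `1`-form `ϑ^P_μ (X) = μ (P (Tτ X))` on `K^*`. -/
def thetaP (P : ∀ m : M, TangentSpace 𝓘(ℝ, E) m →L[ℝ] CharFiber Ω m) :
    DForm (dualModel E F) (DualTotal F Ω) 1 :=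
  DForm.ofOneForm fun μ => (show CharFiber Ω μ.proj →L[ℝ] ℝ from μ.snd) ∘L
    (P μ.proj ∘L tangentProj μ)

/-- The `2`-form `τ^* Ω + d ϑ^P` on `K^*`. -/
def omegaTilde (P : ∀ m : M, TangentSpace 𝓘(ℝ, E) m →L[ℝ] CharFiber Ω m) :
    DForm (dualModel E F) (DualTotal F Ω) 2 :=
  DForm.pullback (fun μ : DualTotal F Ω => μ.proj) Ω + (thetaP P).d

/-- `U` is an open neighbourhood of the zero section of `K^*` on which `τ^* Ω + d ϑ^P` is (weakly)
nondegenerate, so that it is (the domain of) a symplectic thickening. -/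
structure IsSymplecticThickening
    (P : ∀ m : M, TangentSpace 𝓘(ℝ, E) m →L[ℝ] CharFiber Ω m)
    (U : Set (DualTotal F Ω)) : Prop where
  isOpen : IsOpen U
  zero_mem : ∀ m : M, (⟨m, (0 : CharFiber Ω m →L[ℝ] ℝ)⟩ : DualTotal F Ω) ∈ U
  nondegenerate : ∀ μ ∈ U, (omegaTilde P).ker μ = ⊥

variable [IsManifold 𝓘(ℝ, E) ∞ M] [ContMDiffVectorBundle ∞ F (CharFiber Ω) 𝓘(ℝ, E)]

/-- `Z` is a lift to `U ⊆ K^*` of the vertical part of `X`: it is smooth and satisfies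
`Tτ Z = X_V` and `L_Z ϑ^P = 0` on `U`. -/
structure IsVerticalLift
    (P : ∀ m : M, TangentSpace 𝓘(ℝ, E) m →L[ℝ] CharFiber Ω m)
    (U : Set (DualTotal F Ω)) (X : ∀ m : M, TangentSpace 𝓘(ℝ, E) m)
    (Z : ∀ μ : DualTotal F Ω, TangentSpace (dualModel E F) μ) : Prop where
  smooth : SmoothFieldOn Z U
  proj : ∀ μ ∈ U, tangentProj μ (Z μ) = vertPart P X μ.proj
  lie : ∀ μ ∈ U, (thetaP P).lie Z μ = 0

/-- `Z` is a lift to `U ⊆ K^*` of the horizontal part of `X`: it is smooth, satisfies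
`Tτ Z = X_H` on `U`, and near every point is annihilated by the differentials of the fibre
coordinates of some local frame of `K` adapted to `P`. -/
structure IsHorizontalLift
    (P : ∀ m : M, TangentSpace 𝓘(ℝ, E) m →L[ℝ] CharFiber Ω m)
    (U : Set (DualTotal F Ω)) (X : ∀ m : M, TangentSpace 𝓘(ℝ, E) m)
    (Z : ∀ μ : DualTotal F Ω, TangentSpace (dualModel E F) μ) : Prop where
  smooth : SmoothFieldOn Z U
  proj : ∀ μ ∈ U, tangentProj μ (Z μ) = horPart P X μ.proj
  const : ∀ μ ∈ U, ∃ (O : Set M) (e : ∀ m : M, F ≃L[ℝ] CharFiber Ω m),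
    IsOpen O ∧ μ.proj ∈ O ∧ IsAdaptedFrame P O e ∧
    ∀ ν ∈ U, ν.proj ∈ O → ∀ v : F,
      mfderiv (dualModel E F) 𝓘(ℝ, ℝ) (fibreCoord e v) ν (Z ν) = 0

end Lift

end

/-! The lifted field is Hamiltonian on `U`: with `J μ = μ (P Γ)` (the function `momentum`),
contracting `ω̃ = τ^* Ω + d ϑ` with `ΓV + ΓH` gives `d (h ∘ τ - J)`. As `d ω̃ = 0`, Cartan's formula
and `d ∘ d = 0` yield the theorem. The contraction has three pieces.

The lift projects to `Γ_V + Γ_H = Γ`, so the term `τ^* Ω` contributes `τ^* (i_Γ Ω) = d (h ∘ τ)`.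

For the vertical lift, `i ϑ = J`, so `L ϑ = 0` says that `i d ϑ = -d J`
(`d_thetaP_apply_of_isVerticalLift`).

For the horizontal lift, `i d ϑ = 0`; this is where flatness enters
(`interior_d_thetaP_of_isHorizontalLift`). In a chart, `ϑ` at `(x, α)` is `α ∘ p x`, with `p` the
representative of `P`, and `d ϑ` contains the antisymmetrized derivative of `p`. When one argument
is horizontal, this derivative vanishes on horizontal vectors by flatness and equals the derivative
of the frame on vectors of an adapted frame (`fderiv_chartProj_of_isFlat`). What remains of `i d ϑ`
is the differential of a fibre coordinate along the lift, which is zero. -/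

noncomputable section

/-! ### Exterior calculus on manifolds: naturality of `d`, `d ∘ d = 0`, functions as `0`-forms. -/

namespace DForm

variable {E : Type*} [NormedAddCommGroup E] [NormedSpace ℝ E]
  {H : Type*} [TopologicalSpace H] {I : ModelWithCorners ℝ E H}
  {M : Type*} [TopologicalSpace M] [ChartedSpace H M]
  {E' : Type*} [NormedAddCommGroup E'] [NormedSpace ℝ E']
  {H' : Type*} [TopologicalSpace H'] {I' : ModelWithCorners ℝ E' H'}
  {N : Type*} [TopologicalSpace N] [ChartedSpace H' N] {k : ℕ}

/-- All tangent spaces are definitionally the model space, so vectors at points that are only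
propositionally equal can be compared there without casts. -/
theorem apply_congr (η : DForm I M k) {p q : M} (h : p = q) {v w : Fin k → E} (hvw : v = w) :
    (show (Fin k → E) → ℝ from η p) v = (show (Fin k → E) → ℝ from η q) w := by
  subst h hvw; rfl

theorem d_apply (η : DForm I M k) (p : M) (v : Fin (k + 1) → TangentSpace I p) :
    η.d p v = extDeriv (η.chartRep p) (extChartAt I p p)
      (fun i => mfderiv I 𝓘(ℝ, E) (extChartAt I p) p (v i)) := rfl

theorem pullback_apply (f : N → M) (η : DForm I M k) (q : N) (v : Fin k → TangentSpace I' q) :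
    (DForm.pullback (I' := I') f η) q v = η (f q) (fun i => mfderiv I' I f q (v i)) := rfl

theorem interior_apply (Z : ∀ p : M, TangentSpace I p) (η : DForm I M (k + 1)) (p : M)
    (v : Fin k → TangentSpace I p) :
    η.interior Z p v = η p (Matrix.vecCons (Z p) v) := rfl

theorem eventually_extChartAt_symm [I.Boundaryless] {P : M → Prop} {p : M} (h : ∀ᶠ q in 𝓝 p, P q) :
    ∀ᶠ x in 𝓝 (extChartAt I p p), P ((extChartAt I p).symm x) := by
  have h2 : ContinuousAt (extChartAt I p).symm (extChartAt I p p) := continuousAt_extChartAt_symm p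
  have h3 := h2.tendsto
  rw [extChartAt_to_inv] at h3
  exact h3.eventually h

theorem chartRep_congr [I.Boundaryless] {η η' : DForm I M k} {p : M}
    (h : ∀ᶠ q in 𝓝 p, η q = η' q) :
    η.chartRep p =ᶠ[𝓝 (extChartAt I p p)] η'.chartRep p := by
  filter_upwards [eventually_extChartAt_symm h] with x hx
  simp only [chartRep, hx]

theorem d_congr [I.Boundaryless] {η η' : DForm I M k} {p : M}
    (h : ∀ᶠ q in 𝓝 p, η q = η' q) : η.d p = η'.d p := by
  simp only [d, (chartRep_congr h).extDeriv_eq]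

theorem chartRep_add (η η' : DForm I M k) (p : M) :
    (η + η').chartRep p = η.chartRep p + η'.chartRep p := rfl

theorem d_add {η η' : DForm I M k} {p : M}
    (h : DifferentiableAt ℝ (η.chartRep p) (extChartAt I p p))
    (h' : DifferentiableAt ℝ (η'.chartRep p) (extChartAt I p p)) :
    (η + η').d p = η.d p + η'.d p := by
  ext v
  simp only [d_apply, chartRep_add, extDeriv_add h h']
  rfl

section Naturality

theorem contDiffAt_writtenInExtChartAt [I'.Boundaryless] {f : N → M} {q : N}
    (hf : ContMDiffAt I' I ∞ f q) :
    ContDiffAt ℝ ∞ (writtenInExtChartAt I' I q f) (extChartAt I' q q) := by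
  have := (contMDiffAt_iff.1 hf).2
  rwa [I'.range_eq_univ, contDiffWithinAt_univ] at this

theorem writtenInExtChartAt_self (f : N → M) (q : N) :
    writtenInExtChartAt I' I q f (extChartAt I' q q) = extChartAt I (f q) (f q) := by
  simp [writtenInExtChartAt]

variable [I.Boundaryless] [I'.Boundaryless] [IsManifold I ∞ M] [IsManifold I' ∞ N]

theorem mdifferentiableAt_extChartAt_symm {p : M} {x : E} (hx : x ∈ (extChartAt I p).target) :
    MDifferentiableAt 𝓘(ℝ, E) I (extChartAt I p).symm x :=
  (mdifferentiableOn_extChartAt_symm (I := I) x hx).mdifferentiableAt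
    ((isOpen_extChartAt_target p).mem_nhds hx)

/-- Chain rule for `φ⁻¹ ∘ (φ ∘ f ∘ ψ⁻¹) = f ∘ ψ⁻¹`. A whole neighbourhood is needed because
`extDeriv` is applied to the result. -/
theorem chartRep_pullback_eventuallyEq {f : N → M} {q : N} (hf : ContMDiffAt I' I ∞ f q)
    (η : DForm I M k) :
    (DForm.pullback (I' := I') f η).chartRep q =ᶠ[𝓝 (extChartAt I' q q)] fun y =>
      (η.chartRep (f q) (writtenInExtChartAt I' I q f y)).compContinuousLinearMap
        (fderiv ℝ (writtenInExtChartAt I' I q f) y) := by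
  have h1 : ∀ᶠ q' in 𝓝 q, ContMDiffAt I' I 1 f q' :=
    (contMDiffAt_iff_contMDiffAt_nhds (n := 1) (by simp)).1 (hf.of_le (by norm_cast))
  have h2 : ∀ᶠ q' in 𝓝 q, f q' ∈ (extChartAt I (f q)).source :=
    hf.continuousAt.eventually (extChartAt_source_mem_nhds (f q))
  have h3 : ∀ᶠ y in 𝓝 (extChartAt I' q q), y ∈ (extChartAt I' q).target :=
    extChartAt_target_mem_nhds q
  have h2' := eventually_extChartAt_symm (I := I') h2
  filter_upwards [eventually_extChartAt_symm (I := I') h1, h2'.eventually_nhds, h3] with y hy1 hy2 hy3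
  have hd1 : MDifferentiableAt I' I f ((extChartAt I' q).symm y) := hy1.mdifferentiableAt (by simp)
  have hd2 := mdifferentiableAt_extChartAt_symm hy3
  have hd3 : MDifferentiableAt I 𝓘(ℝ, E) (extChartAt I (f q)) (f ((extChartAt I' q).symm y)) :=
    mdifferentiableAt_extChartAt (by rw [← extChartAt_source I]; exact hy2.self_of_nhds)
  have hd4 : MDifferentiableAt 𝓘(ℝ, E') 𝓘(ℝ, E) (writtenInExtChartAt I' I q f) y :=
    hd3.comp y (hd1.comp y hd2)
  have hd5 : MDifferentiableAt 𝓘(ℝ, E) I (extChartAt I (f q)).symm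
      (writtenInExtChartAt I' I q f y) :=
    mdifferentiableAt_extChartAt_symm ((extChartAt I (f q)).map_source hy2.self_of_nhds)
  have key : ((extChartAt I (f q)).symm ∘ writtenInExtChartAt I' I q f) =ᶠ[𝓝 y]
      (f ∘ (extChartAt I' q).symm) := by
    filter_upwards [hy2] with z hz
    exact (extChartAt I (f q)).left_inv hz
  have hmf := key.mfderiv_eq (I := 𝓘(ℝ, E')) (I' := I)
  rw [mfderiv_comp y hd5 hd4, mfderiv_comp y hd1 hd2] at hmf
  ext v
  refine apply_congr η (key.self_of_nhds).symm (funext fun i => ?_)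
  have := congrArg (fun L : E' →L[ℝ] E => L (v i)) hmf
  rw [mfderiv_eq_fderiv] at this
  exact this.symm

theorem differentiableAt_chartRep_pullback {f : N → M} {q : N} (hf : ContMDiffAt I' I ∞ f q)
    {η : DForm I M k}
    (hη : DifferentiableAt ℝ (η.chartRep (f q)) (extChartAt I (f q) (f q))) :
    DifferentiableAt ℝ ((DForm.pullback (I' := I') f η).chartRep q) (extChartAt I' q q) := by
  refine DifferentiableAt.congr_of_eventuallyEq ?_ (chartRep_pullback_eventuallyEq hf η)
  have hw := contDiffAt_writtenInExtChartAt hf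
  refine DifferentiableAt.continuousAlternatingMapCompContinuousLinearMap ?_ ?_
  · rw [← writtenInExtChartAt_self (I' := I')] at hη
    exact hη.comp _ (hw.differentiableAt (by simp))
  · exact (hw.fderiv_right (m := 1) (by norm_cast)).differentiableAt (by simp)

/-- In charts this is `extDeriv_pullback`; the outer chart derivatives are then matched by the chain
rule for `(φ ∘ f ∘ ψ⁻¹) ∘ ψ = φ ∘ f`. -/
theorem d_pullback {f : N → M} {q : N} (hf : ContMDiffAt I' I ∞ f q) {η : DForm I M k}
    (hη : DifferentiableAt ℝ (η.chartRep (f q)) (extChartAt I (f q) (f q))) :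
    (DForm.pullback (I' := I') f η).d q = DForm.pullback (I' := I') f η.d q := by
  have hw := contDiffAt_writtenInExtChartAt hf
  rw [← writtenInExtChartAt_self (I' := I')] at hη
  ext v
  rw [d_apply, (chartRep_pullback_eventuallyEq hf η).extDeriv_eq,
    extDeriv_pullback hη hw (by simp; norm_cast), pullback_apply, d_apply,
    writtenInExtChartAt_self]
  refine congrArg (extDeriv (η.chartRep (f q)) (extChartAt I (f q) (f q))) (funext fun i => ?_)
  have hd1 : MDifferentiableAt I' 𝓘(ℝ, E') (extChartAt I' q) q :=
    mdifferentiableAt_extChartAt (mem_chart_source _ q)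
  have hd2 : MDifferentiableAt I 𝓘(ℝ, E) (extChartAt I (f q)) (f q) :=
    mdifferentiableAt_extChartAt (mem_chart_source _ _)
  have hd3 : MDifferentiableAt I' I f q := hf.mdifferentiableAt (by simp)
  have hd4 : MDifferentiableAt 𝓘(ℝ, E') 𝓘(ℝ, E) (writtenInExtChartAt I' I q f)
      (extChartAt I' q q) := (hw.differentiableAt (by simp)).mdifferentiableAt
  have key : (writtenInExtChartAt I' I q f ∘ extChartAt I' q) =ᶠ[𝓝 q]
      (extChartAt I (f q) ∘ f) := by
    filter_upwards [extChartAt_source_mem_nhds (I := I') q] with z hz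
    exact congrArg (extChartAt I (f q) ∘ f) ((extChartAt I' q).left_inv hz)
  have hmf := key.mfderiv_eq (I := I') (I' := 𝓘(ℝ, E))
  rw [mfderiv_comp q hd4 hd1, mfderiv_comp q hd2 hd3] at hmf
  have := congrArg (fun L : E' →L[ℝ] E => L (v i)) hmf
  rw [mfderiv_eq_fderiv] at this
  exact this

theorem chartRep_vectorSpace (η : DForm 𝓘(ℝ, E) E k) (x : E) :
    η.chartRep x = fun y => (η y).compContinuousLinearMap
      (NormedSpace.fromTangentSpace (𝕜 := ℝ) y).symm.toContinuousLinearMap := by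
  funext y
  ext v
  refine apply_congr η (by rw [extChartAt_model_space_eq_id]; rfl) (funext fun i => ?_)
  have : ((extChartAt 𝓘(ℝ, E) x).symm : E → E) = id := by
    rw [extChartAt_model_space_eq_id]; rfl
  rw [this, mfderiv_id]; rfl

/-- Chart independence of `d`: the value of `η.d` at a point uses that point's own chart, while the
right-hand side uses the chart at `p` throughout. It is naturality for the map `φ⁻¹`. -/
theorem chartRep_d {η : DForm I M k} {p : M} {x : E} (hx : x ∈ (extChartAt I p).target)
    (hη : DifferentiableAt ℝ (η.chartRep ((extChartAt I p).symm x))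
      (extChartAt I ((extChartAt I p).symm x) ((extChartAt I p).symm x))) :
    η.d.chartRep p x = extDeriv (η.chartRep p) x := by
  have hs : ContMDiffAt 𝓘(ℝ, E) I ∞ (extChartAt I p).symm x :=
    (contMDiffOn_extChartAt_symm p).contMDiffAt ((isOpen_extChartAt_target p).mem_nhds hx)
  have h := d_pullback hs hη
  ext v
  have h' := congrArg (fun L : TangentSpace 𝓘(ℝ, E) x [⋀^Fin (k + 1)]→L[ℝ] ℝ => L v) h
  refine h'.symm.trans ?_
  change extDeriv _ _ (fun i => _) = _
  rw [chartRep_vectorSpace]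
  refine congrArg (extDeriv (η.chartRep p) x) (funext fun i => ?_)
  have : (extChartAt 𝓘(ℝ, E) x : E → E) = id := by
    rw [extChartAt_model_space_eq_id]; rfl
  rw [this, mfderiv_id]; rfl

theorem chartRep_d_eventuallyEq {η : DForm I M k} {p : M}
    (hη : ∀ᶠ q in 𝓝 p, DifferentiableAt ℝ (η.chartRep q) (extChartAt I q q)) :
    η.d.chartRep p =ᶠ[𝓝 (extChartAt I p p)] extDeriv (η.chartRep p) := by
  filter_upwards [eventually_extChartAt_symm hη, extChartAt_target_mem_nhds (I := I) p] with x h1 h2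
  exact chartRep_d h2 h1

theorem differentiableAt_chartRep_d {η : DForm I M k} {p : M}
    (hη : ∀ᶠ q in 𝓝 p, DifferentiableAt ℝ (η.chartRep q) (extChartAt I q q))
    (h2 : ContDiffAt ℝ 2 (η.chartRep p) (extChartAt I p p)) :
    DifferentiableAt ℝ (η.d.chartRep p) (extChartAt I p p) := by
  refine DifferentiableAt.congr_of_eventuallyEq ?_ (chartRep_d_eventuallyEq hη)
  have h1 := (h2.fderiv_right (m := 1) (by norm_num)).differentiableAt (by simp)
  exact ((ContinuousAlternatingMap.alternatizeUncurryFinCLM ℝ E ℝ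
    (n := k)).differentiableAt).comp _ h1

theorem d_d {η : DForm I M k} {p : M}
    (hη : ∀ᶠ q in 𝓝 p, DifferentiableAt ℝ (η.chartRep q) (extChartAt I q q))
    (h2 : ContDiffAt ℝ 2 (η.chartRep p) (extChartAt I p p)) : η.d.d p = 0 := by
  ext v
  rw [d_apply, (chartRep_d_eventuallyEq hη).extDeriv_eq, extDeriv_extDeriv_apply h2 (by simp)]
  rfl

end Naturality

section Functions

variable (I) in
/-- A function as a form of degree zero. -/
def ofFunction (g : M → ℝ) : DForm I M 0 := fun p =>
  ContinuousAlternatingMap.constOfIsEmpty ℝ _ (Fin 0) (g p)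

theorem chartRep_ofFunction (g : M → ℝ) (p : M) :
    (ofFunction I g).chartRep p = fun x => ContinuousAlternatingMap.constOfIsEmpty ℝ E (Fin 0)
      ((g ∘ (extChartAt I p).symm) x) := rfl

variable [I.Boundaryless]

theorem contDiffAt_chartRep_ofFunction {g : M → ℝ} {p : M} (hg : ContMDiffAt I 𝓘(ℝ, ℝ) ∞ g p) :
    ContDiffAt ℝ ∞ ((ofFunction I g).chartRep p) (extChartAt I p p) := by
  have := (contMDiffAt_iff.1 hg).2
  rw [I.range_eq_univ, contDiffWithinAt_univ] at this
  exact (ContinuousAlternatingMap.constOfIsEmptyLIE ℝ E ℝ (Fin 0)).contDiff.contDiffAt.comp _ this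

theorem d_ofFunction_apply {g : M → ℝ} {p : M} (hg : ContMDiffAt I 𝓘(ℝ, ℝ) ∞ g p)
    [IsManifold I ∞ M] (v : Fin 1 → TangentSpace I p) :
    (ofFunction I g).d p v = mfderiv I 𝓘(ℝ, ℝ) g p (v 0) := by
  rw [d_apply, chartRep_ofFunction, extDeriv_constOfIsEmpty]
  have hd1 : MDifferentiableAt I 𝓘(ℝ, E) (extChartAt I p) p :=
    mdifferentiableAt_extChartAt (mem_chart_source _ p)
  have h2 := (contMDiffAt_iff.1 hg).2
  rw [I.range_eq_univ, contDiffWithinAt_univ] at h2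
  have hd2 : MDifferentiableAt 𝓘(ℝ, E) 𝓘(ℝ, ℝ) (g ∘ (extChartAt I p).symm)
      (extChartAt I p p) := (h2.differentiableAt (by simp)).mdifferentiableAt
  have key : ((g ∘ (extChartAt I p).symm) ∘ extChartAt I p) =ᶠ[𝓝 p] g := by
    filter_upwards [extChartAt_source_mem_nhds (I := I) p] with z hz
    exact congrArg g ((extChartAt I p).left_inv hz)
  have hmf := key.mfderiv_eq (I := I) (I' := 𝓘(ℝ, ℝ))
  rw [mfderiv_comp p hd2 hd1] at hmf
  have := congrArg (fun L : E →L[ℝ] ℝ => L (v 0)) hmf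
  rw [mfderiv_eq_fderiv] at this
  exact this

end Functions

end DForm

/-! ### Vector fields and Lie brackets in the preferred chart. -/

section ChartCoordinates

variable {E : Type*} [NormedAddCommGroup E] [NormedSpace ℝ E]
  {M : Type*} [TopologicalSpace M] [ChartedSpace E M]

/-- The representative in the preferred chart at `m₀` of a vector field. -/
def chartField (X : ∀ m : M, TangentSpace 𝓘(ℝ, E) m) (m₀ : M) : E → E :=
  VectorField.mpullback 𝓘(ℝ, E) 𝓘(ℝ, E) (extChartAt 𝓘(ℝ, E) m₀).symm X

variable [IsManifold 𝓘(ℝ, E) ∞ M]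

theorem isInvertible_mfderiv_extChartAt_symm {m₀ : M} {x : E}
    (hx : x ∈ (extChartAt 𝓘(ℝ, E) m₀).target) :
    (mfderiv 𝓘(ℝ, E) 𝓘(ℝ, E) (extChartAt 𝓘(ℝ, E) m₀).symm x).IsInvertible := by
  have : IsManifold 𝓘(ℝ, E) 1 M := .of_le (n := ∞) (by norm_cast)
  have := isInvertible_mfderivWithin_extChartAt_symm hx
  rwa [ModelWithCorners.range_eq_univ, mfderivWithin_univ] at this

theorem mfderiv_extChartAt_symm_chartField (X : ∀ m : M, TangentSpace 𝓘(ℝ, E) m) {m₀ : M} {x : E}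
    (hx : x ∈ (extChartAt 𝓘(ℝ, E) m₀).target) :
    mfderiv 𝓘(ℝ, E) 𝓘(ℝ, E) (extChartAt 𝓘(ℝ, E) m₀).symm x
      (chartField (E := E) X m₀ x) =
      X ((extChartAt 𝓘(ℝ, E) m₀).symm x) := by
  obtain ⟨e, he⟩ := isInvertible_mfderiv_extChartAt_symm hx
  change mfderiv 𝓘(ℝ, E) 𝓘(ℝ, E) (extChartAt 𝓘(ℝ, E) m₀).symm x
    ((mfderiv 𝓘(ℝ, E) 𝓘(ℝ, E) (extChartAt 𝓘(ℝ, E) m₀).symm x).inverse _) = _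
  rw [← he, ContinuousLinearMap.inverse_equiv]
  exact e.apply_symm_apply _

/-- The tangent space at `m₀` is identified with `E` through the preferred chart at `m₀`, so that
chart has derivative the identity there. -/
theorem mfderiv_extChartAt_symm_self (m₀ : M) (v : E) :
    mfderiv 𝓘(ℝ, E) 𝓘(ℝ, E) (extChartAt 𝓘(ℝ, E) m₀).symm (extChartAt 𝓘(ℝ, E) m₀ m₀) v = v := by
  have : IsManifold 𝓘(ℝ, E) 1 M := .of_le (n := ∞) (by norm_cast)
  have := mfderivWithin_range_extChartAt_symm (I := 𝓘(ℝ, E)) (x := m₀)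
  rw [ModelWithCorners.range_eq_univ, mfderivWithin_univ] at this
  rw [this]
  rfl

theorem chartField_self (X : ∀ m : M, TangentSpace 𝓘(ℝ, E) m) (m₀ : M) :
    chartField X m₀ (extChartAt 𝓘(ℝ, E) m₀ m₀) = X m₀ := by
  rw [← mfderiv_extChartAt_symm_self m₀ (chartField X m₀ (extChartAt 𝓘(ℝ, E) m₀ m₀)),
    mfderiv_extChartAt_symm_chartField X (mem_extChartAt_target m₀), extChartAt_to_inv]

theorem mlieBracket_eq_lieBracket_chartField (X Y : ∀ m : M, TangentSpace 𝓘(ℝ, E) m) (m₀ : M) :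
    VectorField.mlieBracket 𝓘(ℝ, E) X Y m₀ =
      VectorField.lieBracket ℝ (chartField X m₀) (chartField Y m₀)
        (extChartAt 𝓘(ℝ, E) m₀ m₀) := by
  have : IsManifold 𝓘(ℝ, E) 1 M := .of_le (n := ∞) (by norm_cast)
  rw [← VectorField.mlieBracketWithin_univ, VectorField.mlieBracketWithin_apply,
    mfderiv_extChartAt_self]
  refine (congrArg (fun L : E →L[ℝ] E => L _)
    (ContinuousLinearMap.inverse_id (R := ℝ) (M := E))).trans ?_
  simp only [ModelWithCorners.range_eq_univ, VectorField.mpullbackWithin_univ, preimage_univ,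
    inter_univ]
  exact congrFun VectorField.lieBracketWithin_univ _

theorem differentiableAt_chartField [CompleteSpace E] {X : ∀ m : M, TangentSpace 𝓘(ℝ, E) m}
    {O : Set M} (hO : IsOpen O) (hX : SmoothFieldOn X O) {m₀ : M} (hm : m₀ ∈ O) :
    DifferentiableAt ℝ (chartField X m₀) (extChartAt 𝓘(ℝ, E) m₀ m₀) := by
  have : IsManifold 𝓘(ℝ, E) 2 M := .of_le (n := ∞) (by norm_cast)
  have h1 : MDifferentiableWithinAt 𝓘(ℝ, E) 𝓘(ℝ, E).tangent
      (fun x ↦ (X x : TangentBundle 𝓘(ℝ, E) M)) univ m₀ :=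
    ((hX.contMDiffAt (hO.mem_nhds hm)).mdifferentiableAt (by simp)).mdifferentiableWithinAt
  have h2 := h1.differentiableWithinAt_mpullbackWithin_vectorField
  simp only [ModelWithCorners.range_eq_univ, VectorField.mpullbackWithin_univ, preimage_univ,
    inter_univ] at h2
  exact differentiableWithinAt_univ.1 h2

/-- The field on the domain of the preferred chart at `m₀` with constant representative `ξ`. -/
def chartConstField (m₀ : M) (ξ : E) (m : M) : TangentSpace 𝓘(ℝ, E) m :=
  (trivializationAt E (TangentSpace 𝓘(ℝ, E)) m₀).symm m ξ

/-- The tangent map of the inverse chart is the inverse of the tangent bundle trivialization, hence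
smooth jointly in point and vector. -/
theorem contMDiffOn_mfderiv_extChartAt_symm (m₀ : M) :
    ContMDiffOn 𝓘(ℝ, E × E) 𝓘(ℝ, E).tangent ∞
      (fun y : E × E => (⟨(extChartAt 𝓘(ℝ, E) m₀).symm y.1,
        mfderiv 𝓘(ℝ, E) 𝓘(ℝ, E) (extChartAt 𝓘(ℝ, E) m₀).symm y.1 y.2⟩ :
          TangentBundle 𝓘(ℝ, E) M))
      ((extChartAt 𝓘(ℝ, E) m₀).target ×ˢ univ) := by
  have : IsManifold 𝓘(ℝ, E) 1 M := .of_le (n := ∞) (by norm_cast)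
  have : IsManifold 𝓘(ℝ, E) (∞ + 1) M := by simpa
  have h1 : ContMDiffOn 𝓘(ℝ, E × E) (𝓘(ℝ, E).prod 𝓘(ℝ, E)) ∞
      (fun y : E × E => ((extChartAt 𝓘(ℝ, E) m₀).symm y.1, y.2))
      ((extChartAt 𝓘(ℝ, E) m₀).target ×ˢ univ) := by
    refine ContMDiffOn.prodMk ?_ contDiff_snd.contMDiff.contMDiffOn
    exact (contMDiffOn_extChartAt_symm m₀).comp contDiff_fst.contMDiff.contMDiffOn
      (fun y hy => hy.1)
  have h2 := (trivializationAt E (TangentSpace 𝓘(ℝ, E)) m₀).contMDiffOn_symm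
    (n := ∞) (IB := 𝓘(ℝ, E))
  have hs : ∀ y : E × E, y.1 ∈ (extChartAt 𝓘(ℝ, E) m₀).target →
      (extChartAt 𝓘(ℝ, E) m₀).symm y.1 ∈ (chartAt E m₀).source := fun y hy => by
    simpa [mfld_simps] using (extChartAt 𝓘(ℝ, E) m₀).map_target hy
  refine (h2.comp h1 ?_).congr ?_
  · intro y hy
    simpa [mfld_simps] using hs y hy.1
  · intro y hy
    have h3 := TangentBundle.symmL_trivializationAt (I := 𝓘(ℝ, E)) (hs y hy.1)
    rw [(extChartAt 𝓘(ℝ, E) m₀).right_inv hy.1, ModelWithCorners.range_eq_univ,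
      mfderivWithin_univ] at h3
    have h4 := (trivializationAt E (TangentSpace 𝓘(ℝ, E)) m₀).mk_symm
      (b := (extChartAt 𝓘(ℝ, E) m₀).symm y.1) (by simpa using hs y hy.1) y.2
    rw [← h3]
    exact (congrArg (fun v : TangentSpace 𝓘(ℝ, E) ((extChartAt 𝓘(ℝ, E) m₀).symm y.1) =>
      (⟨_, v⟩ : TangentBundle 𝓘(ℝ, E) M)) (Trivialization.symmL_apply (R := ℝ)
        (trivializationAt E (TangentSpace 𝓘(ℝ, E)) m₀) (by simpa using hs y hy.1) y.2)).trans h4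

theorem smoothFieldOn_chartConstField (m₀ : M) (ξ : E) :
    SmoothFieldOn (chartConstField m₀ ξ) (chartAt E m₀).source := by
  have : IsManifold 𝓘(ℝ, E) (∞ + 1) M := by simpa
  have h2 := (trivializationAt E (TangentSpace 𝓘(ℝ, E)) m₀).contMDiffOn_symm
    (n := ∞) (IB := 𝓘(ℝ, E))
  have h1 : ContMDiff 𝓘(ℝ, E) (𝓘(ℝ, E).prod 𝓘(ℝ, E)) ∞ (fun m : M => (m, ξ)) :=
    contMDiff_id.prodMk contMDiff_const
  refine (h2.comp h1.contMDiffOn (s := (chartAt E m₀).source) ?_).congr ?_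
  · intro m hm
    simpa [mfld_simps] using hm
  · intro m hm
    exact ((trivializationAt E (TangentSpace 𝓘(ℝ, E)) m₀).mk_symm (by simpa using hm) ξ)

theorem chartConstField_self (m₀ : M) (ξ : E) : chartConstField m₀ ξ m₀ = ξ := by
  have : IsManifold 𝓘(ℝ, E) 1 M := .of_le (n := ∞) (by norm_cast)
  have h := TangentBundle.symmL_trivializationAt (I := 𝓘(ℝ, E)) (mem_chart_source E m₀)
  rw [mfderivWithin_range_extChartAt_symm] at h
  have h2 := congrArg (fun L : E →L[ℝ] E => L ξ) h
  refine Eq.trans ?_ h2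
  exact (Trivialization.symmL_apply (R := ℝ) (trivializationAt E (TangentSpace 𝓘(ℝ, E)) m₀)
    (by simp) ξ).symm

end ChartCoordinates

/-! ### Calculus in Banach spaces. -/

section Calculus

variable {E : Type*} [NormedAddCommGroup E] [NormedSpace ℝ E]
  {E' : Type*} [NormedAddCommGroup E'] [NormedSpace ℝ E']
  {F : Type*} [NormedAddCommGroup F] [NormedSpace ℝ F]

/-- Upgrades joint smoothness to smoothness in operator norm, which is stronger in infinite
dimensions: `L x` is the partial derivative at `(x, 0)` in the second variable. -/
theorem contDiffOn_of_contDiffOn_uncurry {L : E → E' →L[ℝ] F} {s : Set E} (hs : IsOpen s)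
    (h : ContDiffOn ℝ ∞ (fun y : E × E' => L y.1 y.2) (s ×ˢ univ)) : ContDiffOn ℝ ∞ L s := by
  have h1 : ContDiffOn ℝ ∞ (fderiv ℝ (fun y : E × E' => L y.1 y.2)) (s ×ˢ univ) :=
    h.fderiv_of_isOpen (hs.prod isOpen_univ) (by simp)
  have h2 : ContDiffOn ℝ ∞ (fun x => fderiv ℝ (fun y : E × E' => L y.1 y.2) (x, 0)) s :=
    h1.comp (by fun_prop : ContDiff ℝ ∞ fun x : E => (x, (0 : E'))).contDiffOn
      (fun x hx => ⟨hx, mem_univ _⟩)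
  have h3 : ContDiffOn ℝ ∞ (fun x => (fderiv ℝ (fun y : E × E' => L y.1 y.2) (x, 0)) ∘L
      ContinuousLinearMap.inr ℝ E E') s := h2.clm_comp contDiffOn_const
  refine h3.congr fun x hx => ?_
  have hd : DifferentiableAt ℝ (fun y : E × E' => L y.1 y.2) (x, 0) :=
    (h.contDiffAt ((hs.prod isOpen_univ).mem_nhds ⟨hx, mem_univ _⟩)).differentiableAt (by simp)
  have hi : HasFDerivAt (fun w : E' => (x, w)) (ContinuousLinearMap.inr ℝ E E') 0 :=
    hasFDerivAt_prodMk_right x 0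
  exact (L x).hasFDerivAt.unique (HasFDerivAt.comp (0 : E') hd.hasFDerivAt hi)

/-- Differentiating `p X = 0` along `Y` gives `dp(Y) X = -p (dX Y)`, and `p [X, Y] = 0` gives `p (dY
X) = p (dX Y)`; insert both into the product rule for `p Y`. -/
theorem fderiv_sub_fderiv_of_lieBracket {p : E → E →L[ℝ] F} {X Y : E → E} {x : E}
    (hp : DifferentiableAt ℝ p x) (hX : DifferentiableAt ℝ X x) (hY : DifferentiableAt ℝ Y x)
    (hpX : ∀ᶠ y in 𝓝 x, p y (X y) = 0) (hXY : p x (VectorField.lieBracket ℝ X Y x) = 0) :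
    fderiv ℝ p x (X x) (Y x) - fderiv ℝ p x (Y x) (X x) =
      fderiv ℝ (fun y => p y (Y y)) x (X x) := by
  have h1 : fderiv ℝ (fun y => p y (X y)) x = 0 := by
    rw [Filter.EventuallyEq.fderiv_eq (f := fun _ => (0 : F)) hpX]
    simp
  rw [fderiv_clm_apply hp hX] at h1
  have h2 := congrArg (fun L : E →L[ℝ] F => L (Y x)) h1
  rw [fderiv_clm_apply hp hY]
  simp only [VectorField.lieBracket, map_sub] at hXY
  simp at h2 ⊢
  rw [sub_eq_zero] at hXY
  rw [hXY, eq_neg_of_add_eq_zero_left h2]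
  abel_nf

end Calculus

/-! ### Connections and adapted frames in a chart. -/

section LocalConnection

variable {E : Type*} [NormedAddCommGroup E] [NormedSpace ℝ E]
  {M : Type*} [TopologicalSpace M] [ChartedSpace E M]
  {Ω : DForm 𝓘(ℝ, E) M 2}
  {F : Type*} [NormedAddCommGroup F] [NormedSpace ℝ F]
  [TopologicalSpace (TotalSpace F (CharFiber Ω))]
  [FiberBundle F (CharFiber Ω)] [VectorBundle ℝ F (CharFiber Ω)]

variable (F) in
/-- The representative of a connection in the preferred chart and trivialization at `m₀`. -/
def chartProj (P : ∀ m : M, TangentSpace 𝓘(ℝ, E) m →L[ℝ] CharFiber Ω m) (m₀ : M) (x : E) :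
    E →L[ℝ] F :=
  (trivializationAt F (CharFiber Ω) m₀).continuousLinearMapAt ℝ ((extChartAt 𝓘(ℝ, E) m₀).symm x) ∘L
    P ((extChartAt 𝓘(ℝ, E) m₀).symm x) ∘L
      (mfderiv 𝓘(ℝ, E) 𝓘(ℝ, E) (extChartAt 𝓘(ℝ, E) m₀).symm x ∘L
        (NormedSpace.fromTangentSpace (𝕜 := ℝ) x).symm.toContinuousLinearMap)

variable (F Ω) in
/-- The part of the target of the preferred chart at `m₀` over which the characteristic bundle is
trivialized. -/
def chartDomain (m₀ : M) : Set E :=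
  (extChartAt 𝓘(ℝ, E) m₀).target ∩
    (extChartAt 𝓘(ℝ, E) m₀).symm ⁻¹' (trivializationAt F (CharFiber Ω) m₀).baseSet

omit [NormedSpace ℝ F] [VectorBundle ℝ F (CharFiber Ω)] in
theorem isOpen_chartDomain (m₀ : M) : IsOpen (chartDomain Ω F m₀) :=
  (continuousOn_extChartAt_symm m₀).isOpen_inter_preimage (isOpen_extChartAt_target m₀)
    (trivializationAt F (CharFiber Ω) m₀).open_baseSet

omit [NormedSpace ℝ F] [VectorBundle ℝ F (CharFiber Ω)] in
theorem mem_chartDomain (m₀ : M) : extChartAt 𝓘(ℝ, E) m₀ m₀ ∈ chartDomain Ω F m₀ :=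
  ⟨mem_extChartAt_target m₀, by
    rw [mem_preimage, extChartAt_to_inv]; exact mem_baseSet_trivializationAt F _ m₀⟩

/-- The representative of the section `e v` in the preferred trivialization at `m₀`. -/
def chartFrame (e : ∀ m : M, F ≃L[ℝ] CharFiber Ω m) (m₀ : M) (v : F) (x : E) : F :=
  (trivializationAt F (CharFiber Ω) m₀).continuousLinearMapAt ℝ ((extChartAt 𝓘(ℝ, E) m₀).symm x)
    (e ((extChartAt 𝓘(ℝ, E) m₀).symm x) v)

theorem chartFrame_self (e : ∀ m : M, F ≃L[ℝ] CharFiber Ω m) (m₀ : M) (v : F) :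
    chartFrame e m₀ v (extChartAt 𝓘(ℝ, E) m₀ m₀) =
      (trivializationAt F (CharFiber Ω) m₀).continuousLinearMapAt ℝ m₀ (e m₀ v) := by
  rw [chartFrame, extChartAt_to_inv]

variable [IsManifold 𝓘(ℝ, E) ∞ M]

theorem chartProj_chartField (P : ∀ m : M, TangentSpace 𝓘(ℝ, E) m →L[ℝ] CharFiber Ω m)
    (Y : ∀ m : M, TangentSpace 𝓘(ℝ, E) m) {m₀ : M} {x : E}
    (hx : x ∈ (extChartAt 𝓘(ℝ, E) m₀).target) :
    chartProj F P m₀ x (chartField Y m₀ x) =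
      (trivializationAt F (CharFiber Ω) m₀).continuousLinearMapAt ℝ
        ((extChartAt 𝓘(ℝ, E) m₀).symm x) (P _ (Y ((extChartAt 𝓘(ℝ, E) m₀).symm x))) := by
  rw [← mfderiv_extChartAt_symm_chartField Y hx]
  rfl

theorem chartProj_self (P : ∀ m : M, TangentSpace 𝓘(ℝ, E) m →L[ℝ] CharFiber Ω m) (m₀ : M)
    (v : E) :
    chartProj F P m₀ (extChartAt 𝓘(ℝ, E) m₀ m₀) v =
      (trivializationAt F (CharFiber Ω) m₀).continuousLinearMapAt ℝ m₀ (P m₀ v) := by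
  have h : ∀ (q : M) (w : E), q = m₀ → w = v →
      (trivializationAt F (CharFiber Ω) m₀).continuousLinearMapAt ℝ q (P q w) =
      (trivializationAt F (CharFiber Ω) m₀).continuousLinearMapAt ℝ m₀ (P m₀ v) := by
    rintro q w rfl rfl; rfl
  exact h _ _ (extChartAt_to_inv m₀) (mfderiv_extChartAt_symm_self m₀ v)

variable [ContMDiffVectorBundle ∞ F (CharFiber Ω) 𝓘(ℝ, E)]

theorem contDiffOn_chartProj {P : ∀ m : M, TangentSpace 𝓘(ℝ, E) m →L[ℝ] CharFiber Ω m}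
    (hP : IsConnection F Ω P) (m₀ : M) :
    ContDiffOn ℝ ∞ (chartProj F P m₀) (chartDomain Ω F m₀) := by
  refine contDiffOn_of_contDiffOn_uncurry (isOpen_chartDomain m₀) ?_
  have h1 := (hP.smooth.comp_contMDiffOn (contMDiffOn_mfderiv_extChartAt_symm m₀)).mono
    (prod_mono (inter_subset_left (t := (extChartAt 𝓘(ℝ, E) m₀).symm ⁻¹'
      (trivializationAt F (CharFiber Ω) m₀).baseSet)) (subset_refl (univ : Set E)))
  have h2 := (((trivializationAt F (CharFiber Ω) m₀).contMDiffOn_iff (fun y hy => by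
    rw [Trivialization.mem_source]; exact hy.1.2)).1 h1).2
  refine (contMDiffOn_iff_contDiffOn.1 h2).congr fun y hy => ?_
  exact Trivialization.continuousLinearMapAt_apply_of_mem ℝ (trivializationAt F (CharFiber Ω) m₀) hy.1.2 _

omit [VectorBundle ℝ F (CharFiber Ω)] [ContMDiffVectorBundle ∞ F (CharFiber Ω) 𝓘(ℝ, E)] in
theorem smoothFieldOn_vertPart {P : ∀ m : M, TangentSpace 𝓘(ℝ, E) m →L[ℝ] CharFiber Ω m}
    (hK : IsCharBundle F Ω) (hP : IsConnection F Ω P) {X : ∀ m : M, TangentSpace 𝓘(ℝ, E) m}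
    {O : Set M} (hX : SmoothFieldOn X O) : SmoothFieldOn (vertPart P X) O :=
  hK.comp_contMDiffOn (hP.smooth.comp_contMDiffOn hX)

omit [VectorBundle ℝ F (CharFiber Ω)] [ContMDiffVectorBundle ∞ F (CharFiber Ω) 𝓘(ℝ, E)] in
theorem isHorizontalOn_horPart {P : ∀ m : M, TangentSpace 𝓘(ℝ, E) m →L[ℝ] CharFiber Ω m}
    (hK : IsCharBundle F Ω) (hP : IsConnection F Ω P) {X : ∀ m : M, TangentSpace 𝓘(ℝ, E) m}
    {O : Set M} (hX : SmoothFieldOn X O) : IsHorizontalOn P (horPart P X) O := by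
  have : IsManifold 𝓘(ℝ, E) (∞ + 1) M := by simpa
  refine ⟨ContMDiffOn.sub_section hX (smoothFieldOn_vertPart hK hP hX), fun m _ => ?_⟩
  change P m (X m - (P m (X m) : CharFiber Ω m)) = 0
  rw [map_sub, hP.proj, sub_self]

omit [VectorBundle ℝ F (CharFiber Ω)] [ContMDiffVectorBundle ∞ F (CharFiber Ω) 𝓘(ℝ, E)] in
theorem IsAdaptedFrame.smoothFieldOn {P : ∀ m : M, TangentSpace 𝓘(ℝ, E) m →L[ℝ] CharFiber Ω m}
    (hK : IsCharBundle F Ω) {O : Set M} {e : ∀ m : M, F ≃L[ℝ] CharFiber Ω m}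
    (he : IsAdaptedFrame P O e) (v : F) :
    SmoothFieldOn (fun m => ((e m v : CharFiber Ω m) : TangentSpace 𝓘(ℝ, E) m)) O :=
  hK.comp_contMDiffOn (he.smooth.comp
    (contMDiff_id.prodMk contMDiff_const : ContMDiff _ _ _ fun m : M => (m, v)).contMDiffOn
      fun _ hm => ⟨hm, mem_univ _⟩)

theorem IsAdaptedFrame.differentiableAt_chartFrame
    {P : ∀ m : M, TangentSpace 𝓘(ℝ, E) m →L[ℝ] CharFiber Ω m}
    {O : Set M} (hO : IsOpen O) {m₀ : M} (hm : m₀ ∈ O) {e : ∀ m : M, F ≃L[ℝ] CharFiber Ω m}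
    (he : IsAdaptedFrame P O e) (v : F) :
    DifferentiableAt ℝ (chartFrame e m₀ v) (extChartAt 𝓘(ℝ, E) m₀ m₀) := by
  have h1 : ContMDiffAt 𝓘(ℝ, E) (𝓘(ℝ, E).prod 𝓘(ℝ, F)) ∞
      (fun m : M => (⟨m, e m v⟩ : TotalSpace F (CharFiber Ω))) m₀ :=
    (he.smooth.comp (s := O)
      (contMDiff_id.prodMk contMDiff_const : ContMDiff _ _ _ fun m : M => (m, v)).contMDiffOn
      fun _ hm => ⟨hm, mem_univ _⟩).contMDiffAt (hO.mem_nhds hm)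
  have h2 := ((trivializationAt F (CharFiber Ω) m₀).contMDiffAt_iff
    (by rw [Trivialization.mem_source]; exact mem_baseSet_trivializationAt F _ m₀)).1 h1
  have h3 := (contMDiffAt_iff.1 h2.2).2
  rw [ModelWithCorners.range_eq_univ, contDiffWithinAt_univ] at h3
  refine (h3.differentiableAt (by simp)).congr_of_eventuallyEq ?_
  filter_upwards [(isOpen_chartDomain (F := F) (Ω := Ω) m₀).mem_nhds (mem_chartDomain m₀)] with x hx
  exact Trivialization.continuousLinearMapAt_apply_of_mem ℝ (trivializationAt F (CharFiber Ω) m₀) hx.2 _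

/-- In a chart, the exterior derivative of a flat connection contracted with a horizontal field is
determined by the adapted frames. -/
theorem fderiv_chartProj_of_isFlat [CompleteSpace E]
    {P : ∀ m : M, TangentSpace 𝓘(ℝ, E) m →L[ℝ] CharFiber Ω m}
    (hK : IsCharBundle F Ω) (hP : IsConnection F Ω P) (hflat : IsFlat P)
    {O : Set M} (hO : IsOpen O) {m₀ : M} (hm : m₀ ∈ O)
    {X : ∀ m : M, TangentSpace 𝓘(ℝ, E) m} (hX : IsHorizontalOn P X O)
    {e : ∀ m : M, F ≃L[ℝ] CharFiber Ω m} (he : IsAdaptedFrame P O e) (v : F) (ξ : E)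
    (hξ : chartProj F P m₀ (extChartAt 𝓘(ℝ, E) m₀ m₀) ξ =
      chartFrame e m₀ v (extChartAt 𝓘(ℝ, E) m₀ m₀)) :
    fderiv ℝ (chartProj F P m₀) (extChartAt 𝓘(ℝ, E) m₀ m₀) (X m₀) ξ -
      fderiv ℝ (chartProj F P m₀) (extChartAt 𝓘(ℝ, E) m₀ m₀) ξ (X m₀) =
      fderiv ℝ (chartFrame e m₀ v) (extChartAt 𝓘(ℝ, E) m₀ m₀) (X m₀) := by
  have hp : DifferentiableAt ℝ (chartProj F P m₀) (extChartAt 𝓘(ℝ, E) m₀ m₀) :=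
    ((contDiffOn_chartProj hP m₀).contDiffAt
      ((isOpen_chartDomain m₀).mem_nhds (mem_chartDomain m₀))).differentiableAt (by simp)
  -- The bracket identity is used for two fields `Y`: a section of the adapted frame, and a
  -- horizontal field.
  have main : ∀ (O' : Set M), IsOpen O' → m₀ ∈ O' → O' ⊆ O →
      ∀ Y : (∀ m : M, TangentSpace 𝓘(ℝ, E) m), SmoothFieldOn Y O' →
      P m₀ (VectorField.mlieBracket 𝓘(ℝ, E) X Y m₀) = 0 →
      ∀ (g : E → F), (∀ᶠ x in 𝓝 (extChartAt 𝓘(ℝ, E) m₀ m₀),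
        (trivializationAt F (CharFiber Ω) m₀).continuousLinearMapAt ℝ
          ((extChartAt 𝓘(ℝ, E) m₀).symm x) (P _ (Y ((extChartAt 𝓘(ℝ, E) m₀).symm x))) = g x) →
      fderiv ℝ (chartProj F P m₀) (extChartAt 𝓘(ℝ, E) m₀ m₀) (X m₀) (Y m₀) -
      fderiv ℝ (chartProj F P m₀) (extChartAt 𝓘(ℝ, E) m₀ m₀) (Y m₀) (X m₀) =
      fderiv ℝ g (extChartAt 𝓘(ℝ, E) m₀ m₀) (X m₀) := by
    intro O' hO' hm' hOO Y hY hXY g hg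
    have ht := extChartAt_target_mem_nhds (I := 𝓘(ℝ, E)) m₀
    have h := fderiv_sub_fderiv_of_lieBracket hp (differentiableAt_chartField hO hX.1 hm)
      (differentiableAt_chartField hO' hY hm') ?_ ?_
    · rw [chartField_self, chartField_self] at h
      rw [h]
      refine congrArg (fun L : E →L[ℝ] F => L (X m₀)) (Filter.EventuallyEq.fderiv_eq ?_)
      filter_upwards [hg, ht] with x h1 h2
      rw [← h1]
      exact chartProj_chartField P Y h2
    · filter_upwards [DForm.eventually_extChartAt_symm (I := 𝓘(ℝ, E)) (hO.mem_nhds hm), ht] with x h1 h2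
      rw [chartProj_chartField P X h2, hX.2 _ h1, map_zero]
    · refine (congrArg (chartProj F P m₀ _)
        (mlieBracket_eq_lieBracket_chartField X Y m₀).symm).trans ((chartProj_self P m₀ _).trans ?_)
      rw [hXY, map_zero]
  -- Split `ξ = w + (ξ - w)` with `w = e v` in the kernel; `hξ` makes the remainder horizontal.
  obtain ⟨w, hw⟩ : ∃ w : E, w = ((e m₀ v : CharFiber Ω m₀) : TangentSpace 𝓘(ℝ, E) m₀) := ⟨_, rfl⟩
  have hPw : P m₀ w = e m₀ v := by rw [hw]; exact hP.proj m₀ _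
  have hPξ : P m₀ (ξ - w : E) = 0 := by
    have h1 : chartProj F P m₀ (extChartAt 𝓘(ℝ, E) m₀ m₀) (ξ - w) = 0 := by
      rw [map_sub, hξ, chartProj_self, hPw, chartFrame_self, sub_self]
    rw [chartProj_self] at h1
    rw [← (trivializationAt F (CharFiber Ω) m₀).symmL_continuousLinearMapAt (R := ℝ)
      (mem_baseSet_trivializationAt F _ m₀) (P m₀ (ξ - w : E)), h1, map_zero]
  have h1 := main O hO hm subset_rfl _ (he.smoothFieldOn hK v) (he.invariant v O hO subset_rfl X hX
    m₀ hm) (chartFrame e m₀ v) (.of_forall fun x => by rw [hP.proj]; rfl)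
  -- Flatness concerns fields, so `ξ - w` is extended to a horizontal one: the horizontal part of a
  -- chart-constant field, which keeps the value `ξ - w` at `m₀`.
  have hs := isHorizontalOn_horPart hK hP (smoothFieldOn_chartConstField m₀ (ξ - w))
  have hO' := hO.inter (chartAt E m₀).open_source
  have hm' : m₀ ∈ O ∩ (chartAt E m₀).source := ⟨hm, mem_chart_source E m₀⟩
  have hs' : IsHorizontalOn P (horPart P (chartConstField m₀ (ξ - w)))
    (O ∩ (chartAt E m₀).source) := ⟨hs.1.mono inter_subset_right, fun m hm => hs.2 m hm.2⟩
  have h2 := main _ hO' hm' inter_subset_left _ hs'.1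
    (hflat _ hO' X _ ⟨hX.1.mono inter_subset_left, fun m hm => hX.2 m hm.1⟩ hs' m₀ hm')
    (fun _ => 0) (by
      filter_upwards [DForm.eventually_extChartAt_symm (I := 𝓘(ℝ, E)) (hO'.mem_nhds hm')] with x hx
      rw [hs'.2 _ hx, map_zero])
  have h3 : horPart P (chartConstField m₀ (ξ - w)) m₀ = (ξ - w : E) := by
    rw [horPart, vertPart, chartConstField_self, hPξ]
    exact sub_zero (ξ - w)
  rw [h3] at h2
  rw [← hw] at h1
  have key : ∀ (A : E →L[ℝ] E →L[ℝ] F) (B : E →L[ℝ] F) (x : E), A x w - A w x = B x →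
      A x (ξ - w) - A (ξ - w) x = 0 → A x ξ - A ξ x = B x := by
    intro A B x h1 h2
    simp only [map_sub, sub_apply] at h2
    rw [← h1, ← sub_eq_zero, ← h2]
    abel
  exact key _ _ _ h1 (h2.trans (by rw [fderiv_fun_const]; rfl))

end LocalConnection

/-! ### One-forms on a normed space. -/

section OneForms

variable {G : Type*} [NormedAddCommGroup G] [NormedSpace ℝ G] {L : G → G →L[ℝ] ℝ} {x : G}

theorem contDiffAt_ofSubsingleton {n : WithTop ℕ∞} (hL : ContDiffAt ℝ n L x) :
    ContDiffAt ℝ n (fun y => ContinuousAlternatingMap.ofSubsingleton ℝ G ℝ (0 : Fin 1) (L y)) x :=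
  (ContinuousAlternatingMap.ofSubsingletonLIE (𝕜 := ℝ) (E := G) (F := ℝ)
    (0 : Fin 1)).contDiff.contDiffAt.comp _ hL

theorem extDeriv_ofSubsingleton_apply (hL : DifferentiableAt ℝ L x) (z w : G) :
    extDeriv (fun y => ContinuousAlternatingMap.ofSubsingleton ℝ G ℝ (0 : Fin 1) (L y)) x ![z, w] =
      fderiv ℝ (fun y => L y w) x z - fderiv ℝ (fun y => L y z) x w := by
  have hd : DifferentiableAt ℝ
      (fun y => ContinuousAlternatingMap.ofSubsingleton ℝ G ℝ (0 : Fin 1) (L y)) x :=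
    (ContinuousAlternatingMap.ofSubsingletonLIE (𝕜 := ℝ) (E := G) (F := ℝ)
      (0 : Fin 1)).differentiable.differentiableAt.comp _ hL
  rw [extDeriv_apply hd, Fin.sum_univ_two]
  simp [Fin.removeNth, sub_eq_add_neg]

end OneForms

/-! ### The one-form `ϑ^P` in bundle charts, and horizontal lifts. -/

section DualBundle

variable {E : Type*} [NormedAddCommGroup E] [NormedSpace ℝ E]
  {M : Type*} [TopologicalSpace M] [ChartedSpace E M]
  {Ω : DForm 𝓘(ℝ, E) M 2}
  {F : Type*} [NormedAddCommGroup F] [NormedSpace ℝ F]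
  [TopologicalSpace (TotalSpace F (CharFiber Ω))]
  [FiberBundle F (CharFiber Ω)] [VectorBundle ℝ F (CharFiber Ω)]

theorem extChartAt_dual_target (μ₀ : DualTotal F Ω) :
    (extChartAt (dualModel E F) μ₀).target = chartDomain Ω F μ₀.proj ×ˢ univ := by
  rw [FiberBundle.extChartAt_target]
  simp [chartDomain]

theorem extChartAt_dual_fst (μ₀ : DualTotal F Ω) :
    (extChartAt (dualModel E F) μ₀ μ₀).1 = extChartAt 𝓘(ℝ, E) μ₀.proj μ₀.proj := by
  rw [FiberBundle.extChartAt]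
  rfl

theorem extChartAt_dual_symm (μ₀ : DualTotal F Ω) (y : E × (F →L[ℝ] ℝ)) :
    (extChartAt (dualModel E F) μ₀).symm y =
      ⟨(extChartAt 𝓘(ℝ, E) μ₀.proj).symm y.1,
        y.2 ∘L (trivializationAt F (CharFiber Ω) μ₀.proj).continuousLinearMapAt ℝ
          ((extChartAt 𝓘(ℝ, E) μ₀.proj).symm y.1)⟩ := by
  rw [FiberBundle.extChartAt, hom_trivializationAt]
  change (⟨_, ContinuousLinearMap.comp _ _⟩ : DualTotal F Ω) = _
  congr 1
  ext k
  simp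
  rfl

variable [IsManifold 𝓘(ℝ, E) ∞ M] [ContMDiffVectorBundle ∞ F (CharFiber Ω) 𝓘(ℝ, E)]

theorem tangentProj_mfderiv_extChartAt_symm (μ₀ : DualTotal F Ω) {y : E × (F →L[ℝ] ℝ)}
    (hy : y.1 ∈ chartDomain Ω F μ₀.proj) (w : E × (F →L[ℝ] ℝ)) :
    (show E from tangentProj ((extChartAt (dualModel E F) μ₀).symm y)
      (mfderiv 𝓘(ℝ, E × (F →L[ℝ] ℝ)) (dualModel E F) (extChartAt (dualModel E F) μ₀).symm y w)) =
    (show E → E from mfderiv 𝓘(ℝ, E) 𝓘(ℝ, E) (extChartAt 𝓘(ℝ, E) μ₀.proj).symm y.1) w.1 := by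
  have hy' : y ∈ (extChartAt (dualModel E F) μ₀).target := by
    rw [extChartAt_dual_target]; exact ⟨hy, mem_univ _⟩
  have hd1 : MDifferentiableAt 𝓘(ℝ, E × (F →L[ℝ] ℝ)) (dualModel E F)
    (extChartAt (dualModel E F) μ₀).symm y := DForm.mdifferentiableAt_extChartAt_symm hy'
  have hd2 : MDifferentiableAt (dualModel E F) 𝓘(ℝ, E) (fun ν : DualTotal F Ω => ν.proj)
      ((extChartAt (dualModel E F) μ₀).symm y) :=
    (contMDiffAt_proj (n := 1) (CharDual Ω)).mdifferentiableAt (by simp)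
  have hd3 : MDifferentiableAt 𝓘(ℝ, E) 𝓘(ℝ, E) (extChartAt 𝓘(ℝ, E) μ₀.proj).symm y.1 :=
    DForm.mdifferentiableAt_extChartAt_symm hy.1
  have hd4 : MDifferentiableAt 𝓘(ℝ, E × (F →L[ℝ] ℝ)) 𝓘(ℝ, E)
      (Prod.fst : E × (F →L[ℝ] ℝ) → E) y := differentiableAt_fst.mdifferentiableAt
  have key : ((fun ν : DualTotal F Ω => ν.proj) ∘ (extChartAt (dualModel E F) μ₀).symm)
      =ᶠ[𝓝 y] ((extChartAt 𝓘(ℝ, E) μ₀.proj).symm ∘ Prod.fst) := by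
    refine .of_forall fun z => ?_
    simp only [Function.comp, extChartAt_dual_symm μ₀ z]
  have hmf := key.mfderiv_eq (I := 𝓘(ℝ, E × (F →L[ℝ] ℝ))) (I' := 𝓘(ℝ, E))
  rw [mfderiv_comp y hd2 hd1, mfderiv_comp y hd3 hd4] at hmf
  have := congrArg (fun L : E × (F →L[ℝ] ℝ) →L[ℝ] E => L w) hmf
  refine this.trans ?_
  have hf : mfderiv 𝓘(ℝ, E × (F →L[ℝ] ℝ)) 𝓘(ℝ, E) (Prod.fst : E × (F →L[ℝ] ℝ) → E) y =
      ContinuousLinearMap.fst ℝ E (F →L[ℝ] ℝ) := by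
    rw [mfderiv_eq_fderiv]; exact fderiv_fst
  rw [hf]
  rfl

theorem chartRep_thetaP (P : ∀ m : M, TangentSpace 𝓘(ℝ, E) m →L[ℝ] CharFiber Ω m)
    (μ₀ : DualTotal F Ω) {y : E × (F →L[ℝ] ℝ)} (hy : y.1 ∈ chartDomain Ω F μ₀.proj) :
    (thetaP P).chartRep μ₀ y = ContinuousAlternatingMap.ofSubsingleton ℝ _ ℝ (0 : Fin 1)
      (y.2 ∘L chartProj F P μ₀.proj y.1 ∘L ContinuousLinearMap.fst ℝ E (F →L[ℝ] ℝ)) := by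
  -- Generalizing over the point and the vector lets equalities of base points be substituted
  -- despite the dependent fibres.
  have h : ∀ (ν : DualTotal F Ω) (m : M) (α : CharFiber Ω m →L[ℝ] ℝ) (u w : E), ν = ⟨m, α⟩ →
      u = w → ν.snd (P ν.proj u) = α (P m w) := by
    rintro ν m α u w rfl rfl; rfl
  ext v
  exact h _ _ _ _ _ (extChartAt_dual_symm μ₀ y) (tangentProj_mfderiv_extChartAt_symm μ₀ hy (v 0))

theorem chartRep_thetaP_eventuallyEq
    (P : ∀ m : M, TangentSpace 𝓘(ℝ, E) m →L[ℝ] CharFiber Ω m) (μ₀ : DualTotal F Ω) :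
    (thetaP P).chartRep μ₀ =ᶠ[𝓝 (extChartAt (dualModel E F) μ₀ μ₀)] fun y =>
      ContinuousAlternatingMap.ofSubsingleton ℝ _ ℝ (0 : Fin 1)
      (y.2 ∘L chartProj F P μ₀.proj y.1 ∘L ContinuousLinearMap.fst ℝ E (F →L[ℝ] ℝ)) := by
  filter_upwards [extChartAt_target_mem_nhds (I := dualModel E F) μ₀] with y hy
  rw [extChartAt_dual_target] at hy
  exact chartRep_thetaP P μ₀ hy.1

theorem contDiffAt_chartProj {P : ∀ m : M, TangentSpace 𝓘(ℝ, E) m →L[ℝ] CharFiber Ω m}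
    (hP : IsConnection F Ω P) (m₀ : M) :
    ContDiffAt ℝ ∞ (chartProj F P m₀) (extChartAt 𝓘(ℝ, E) m₀ m₀) :=
  (contDiffOn_chartProj hP m₀).contDiffAt ((isOpen_chartDomain m₀).mem_nhds (mem_chartDomain m₀))

theorem contDiffAt_chartRep_thetaP {P : ∀ m : M, TangentSpace 𝓘(ℝ, E) m →L[ℝ] CharFiber Ω m}
    (hP : IsConnection F Ω P) (μ₀ : DualTotal F Ω) :
    ContDiffAt ℝ ∞ ((thetaP P).chartRep μ₀) (extChartAt (dualModel E F) μ₀ μ₀) := by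
  refine ContDiffAt.congr_of_eventuallyEq ?_ (chartRep_thetaP_eventuallyEq P μ₀)
  have h1 := contDiffAt_chartProj hP μ₀.proj
  rw [← extChartAt_dual_fst] at h1
  have h2 : ContDiffAt ℝ ∞ (fun y : E × (F →L[ℝ] ℝ) => chartProj F P μ₀.proj y.1)
    (extChartAt (dualModel E F) μ₀ μ₀) := h1.comp _ contDiffAt_fst
  exact contDiffAt_ofSubsingleton (contDiffAt_snd.clm_comp (h2.clm_comp contDiffAt_const))

theorem tangentProj_apply (μ₀ : DualTotal F Ω) (w : E × (F →L[ℝ] ℝ)) :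
    tangentProj μ₀ w = w.1 := by
  have h := tangentProj_mfderiv_extChartAt_symm μ₀ (y := extChartAt (dualModel E F) μ₀ μ₀)
    (by rw [extChartAt_dual_fst]; exact mem_chartDomain _) w
  have : IsManifold (dualModel E F) 1 (DualTotal F Ω) := .of_le (n := ∞) (by norm_cast)
  have h2 := mfderivWithin_range_extChartAt_symm (I := dualModel E F) (x := μ₀)
  rw [ModelWithCorners.range_eq_univ, mfderivWithin_univ] at h2
  have h3 : ∀ (ν : DualTotal F Ω) (u : E × (F →L[ℝ] ℝ)), ν = μ₀ → u = w →
      (show E from tangentProj ν u) = tangentProj μ₀ w := by rintro _ _ rfl rfl; rfl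
  refine (h3 _ _ (extChartAt_to_inv μ₀) (congrArg
    (fun L : E × (F →L[ℝ] ℝ) →L[ℝ] E × (F →L[ℝ] ℝ) => L w) h2)).symm.trans (h.trans ?_)
  rw [extChartAt_dual_fst]
  exact mfderiv_extChartAt_symm_self _ _

theorem fderiv_apply_chart {p : E → F} {y : E × (F →L[ℝ] ℝ)} (hp : DifferentiableAt ℝ p y.1)
    (w : E × (F →L[ℝ] ℝ)) :
    fderiv ℝ (fun y : E × (F →L[ℝ] ℝ) => y.2 (p y.1)) y w =
      w.2 (p y.1) + y.2 (fderiv ℝ p y.1 w.1) := by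
  have h1 : HasFDerivAt (fun y : E × (F →L[ℝ] ℝ) => p y.1)
    (fderiv ℝ p y.1 ∘L ContinuousLinearMap.fst ℝ E (F →L[ℝ] ℝ)) y :=
    hp.hasFDerivAt.comp y hasFDerivAt_fst
  have h2 : HasFDerivAt (fun y : E × (F →L[ℝ] ℝ) => y.2)
    (ContinuousLinearMap.snd ℝ E (F →L[ℝ] ℝ)) y := hasFDerivAt_snd
  rw [(h2.clm_apply h1).fderiv]
  simp [add_comm]

/-- Product rule for `(x, α) ↦ α (p x ξ)`: the first two terms differentiate `α`, the last one
differentiates `p`. -/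
theorem d_thetaP_apply {P : ∀ m : M, TangentSpace 𝓘(ℝ, E) m →L[ℝ] CharFiber Ω m}
    (hP : IsConnection F Ω P) (μ₀ : DualTotal F Ω) (z w : E × (F →L[ℝ] ℝ)) :
    (thetaP P).d μ₀ ![z, w] =
      z.2 (chartProj F P μ₀.proj (extChartAt 𝓘(ℝ, E) μ₀.proj μ₀.proj) w.1) -
      w.2 (chartProj F P μ₀.proj (extChartAt 𝓘(ℝ, E) μ₀.proj μ₀.proj) z.1) +
      (extChartAt (dualModel E F) μ₀ μ₀).2
        (fderiv ℝ (chartProj F P μ₀.proj) (extChartAt 𝓘(ℝ, E) μ₀.proj μ₀.proj) z.1 w.1 -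
          fderiv ℝ (chartProj F P μ₀.proj) (extChartAt 𝓘(ℝ, E) μ₀.proj μ₀.proj) w.1 z.1) := by
  have : IsManifold (dualModel E F) 1 (DualTotal F Ω) := .of_le (n := ∞) (by norm_cast)
  have hp := (contDiffAt_chartProj hP μ₀.proj).differentiableAt (by simp)
  have h1 : (thetaP P).d μ₀ ![z, w] = extDeriv ((thetaP P).chartRep μ₀)
      (extChartAt (dualModel E F) μ₀ μ₀) ![z, w] := by
    rw [DForm.d_apply, mfderiv_extChartAt_self]
    rfl
  rw [← extChartAt_dual_fst] at hp ⊢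
  have hpy : DifferentiableAt ℝ (fun y : E × (F →L[ℝ] ℝ) => chartProj F P μ₀.proj y.1)
    (extChartAt (dualModel E F) μ₀ μ₀) := hp.comp _ differentiableAt_fst
  have hc : ∀ a ξ : E, fderiv ℝ (fun x => chartProj F P μ₀.proj x ξ)
      (extChartAt (dualModel E F) μ₀ μ₀).1 a =
      fderiv ℝ (chartProj F P μ₀.proj) (extChartAt (dualModel E F) μ₀ μ₀).1 a ξ := fun a ξ => by
    rw [fderiv_clm_apply hp (differentiableAt_const ξ)]
    simp
  rw [h1, (chartRep_thetaP_eventuallyEq P μ₀).extDeriv_eq, extDeriv_ofSubsingleton_apply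
    (differentiableAt_snd.clm_comp (hpy.clm_comp (differentiableAt_const _)))]
  have hA : ∀ u z : E × (F →L[ℝ] ℝ), fderiv ℝ (fun y : E × (F →L[ℝ] ℝ) =>
      (y.2 ∘L chartProj F P μ₀.proj y.1 ∘L ContinuousLinearMap.fst ℝ E (F →L[ℝ] ℝ)) u)
      (extChartAt (dualModel E F) μ₀ μ₀) z = _ := fun u z =>
    fderiv_apply_chart (p := fun x => chartProj F P μ₀.proj x u.1)
      (hp.clm_apply (differentiableAt_const _)) z
  rw [hA, hA, hc, hc, map_sub]
  ring

/-- In the bundle chart the fibre coordinate is `(x, α) ↦ α (a x)`, with `a` the representative of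
`e v`; the product rule gives the two terms. -/
theorem fderiv_chartFrame_of_const (e : ∀ m : M, F ≃L[ℝ] CharFiber Ω m) (v : F)
    (μ₀ : DualTotal F Ω) (z : E × (F →L[ℝ] ℝ))
    (ha : DifferentiableAt ℝ (chartFrame e μ₀.proj v) (extChartAt 𝓘(ℝ, E) μ₀.proj μ₀.proj))
    (hz : mfderiv (dualModel E F) 𝓘(ℝ, ℝ) (fibreCoord e v) μ₀ z = 0) :
    z.2 (chartFrame e μ₀.proj v (extChartAt 𝓘(ℝ, E) μ₀.proj μ₀.proj)) +
      (extChartAt (dualModel E F) μ₀ μ₀).2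
        (fderiv ℝ (chartFrame e μ₀.proj v) (extChartAt 𝓘(ℝ, E) μ₀.proj μ₀.proj) z.1) = 0 := by
  have : IsManifold (dualModel E F) 1 (DualTotal F Ω) := .of_le (n := ∞) (by norm_cast)
  rw [← extChartAt_dual_fst] at ha ⊢
  have hd1 : MDifferentiableAt (dualModel E F) 𝓘(ℝ, E × (F →L[ℝ] ℝ))
    (extChartAt (dualModel E F) μ₀) μ₀ := mdifferentiableAt_extChartAt (mem_chart_source _ μ₀)
  have hd2 : DifferentiableAt ℝ (fun y : E × (F →L[ℝ] ℝ) => y.2 (chartFrame e μ₀.proj v y.1))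
      (extChartAt (dualModel E F) μ₀ μ₀) :=
    differentiableAt_snd.clm_apply (ha.comp _ differentiableAt_fst)
  have key : (fun y : E × (F →L[ℝ] ℝ) => y.2 (chartFrame e μ₀.proj v y.1)) ∘
      (extChartAt (dualModel E F) μ₀) =ᶠ[𝓝 μ₀] fibreCoord e v := by
    filter_upwards [extChartAt_source_mem_nhds (I := dualModel E F) μ₀] with ν hν
    refine Eq.trans ?_ (congrArg (fibreCoord e v) ((extChartAt (dualModel E F) μ₀).left_inv hν))
    rw [extChartAt_dual_symm]
    rfl
  have hmf := key.mfderiv_eq (I := dualModel E F) (I' := 𝓘(ℝ, ℝ))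
  rw [mfderiv_comp μ₀ hd2.mdifferentiableAt hd1, mfderiv_extChartAt_self] at hmf
  rw [← fderiv_apply_chart ha z]
  have := congrArg (fun L : E × (F →L[ℝ] ℝ) →L[ℝ] ℝ => L z) hmf
  rw [mfderiv_eq_fderiv] at this
  exact this.trans hz

theorem interior_d_thetaP_of_isHorizontalLift [CompleteSpace E]
    {P : ∀ m : M, TangentSpace 𝓘(ℝ, E) m →L[ℝ] CharFiber Ω m}
    (hK : IsCharBundle F Ω) (hP : IsConnection F Ω P) (hflat : IsFlat P)
    {U : Set (DualTotal F Ω)} {X : ∀ m : M, TangentSpace 𝓘(ℝ, E) m} (hX : SmoothFieldOn X univ)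
    {Z : ∀ μ : DualTotal F Ω, TangentSpace (dualModel E F) μ} (hZ : IsHorizontalLift P U X Z)
    {μ : DualTotal F Ω} (hμ : μ ∈ U) : ((thetaP P).d).interior Z μ = 0 := by
  obtain ⟨O, e, hO, hμO, he, hc⟩ := hZ.const μ hμ
  obtain ⟨z, hz⟩ : ∃ z : E × (F →L[ℝ] ℝ), z = Z μ := ⟨_, rfl⟩
  have hz1 : z.1 = horPart P X μ.proj := by
    rw [← hZ.proj μ hμ, ← hz]
    exact (tangentProj_apply μ z).symm
  have hh := isHorizontalOn_horPart hK hP (hX.mono (subset_univ O))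
  ext w'
  obtain ⟨w, hw⟩ : ∃ w : E × (F →L[ℝ] ℝ), w = w' 0 := ⟨_, rfl⟩
  have h1 : ((thetaP P).d).interior Z μ w' = (thetaP P).d μ ![z, w] := by
    rw [DForm.interior_apply, hz, hw]
    congr 2
    ext i
    fin_cases i
    rfl
  rw [h1, d_thetaP_apply hP]
  set x₀ := extChartAt 𝓘(ℝ, E) μ.proj μ.proj
  have hpz : chartProj F P μ.proj x₀ z.1 = 0 := by
    rw [chartProj_self, hz1, hh.2 _ hμO, map_zero]
  -- The frame index `v` is the coordinate of `P w.1` in the frame at `μ.proj`, so that `w.1` and `e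
  -- v` differ by a horizontal vector.
  have hv : chartProj F P μ.proj x₀ w.1 =
      chartFrame e μ.proj ((e μ.proj).symm (P μ.proj w.1)) x₀ := by
    rw [chartProj_self, chartFrame_self, ContinuousLinearEquiv.apply_symm_apply]
  have hf := fderiv_chartProj_of_isFlat hK hP hflat hO hμO hh he _ w.1 hv
  rw [← hz1] at hf
  rw [hpz, map_zero, sub_zero, hf, hv]
  exact fderiv_chartFrame_of_const e _ μ z (he.differentiableAt_chartFrame hO hμO _)
    (by rw [hz]; exact hc μ hμ hμO _)

end DualBundle

/-! ### Vertical lifts, the Hamiltonian of the full lift, and closedness of `ω̃`. -/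

section Lifts

variable {E : Type*} [NormedAddCommGroup E] [NormedSpace ℝ E]
  {M : Type*} [TopologicalSpace M] [ChartedSpace E M]
  {Ω : DForm 𝓘(ℝ, E) M 2}
  {F : Type*} [NormedAddCommGroup F] [NormedSpace ℝ F]
  [TopologicalSpace (TotalSpace F (CharFiber Ω))]
  [FiberBundle F (CharFiber Ω)] [VectorBundle ℝ F (CharFiber Ω)]

/-- The function `μ ↦ μ (P X)` on `K^*`. -/
def momentum (P : ∀ m : M, TangentSpace 𝓘(ℝ, E) m →L[ℝ] CharFiber Ω m)
    (X : ∀ m : M, TangentSpace 𝓘(ℝ, E) m) (μ : DualTotal F Ω) : ℝ :=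
  μ.snd (P μ.proj (X μ.proj))

variable [IsManifold 𝓘(ℝ, E) ∞ M] [ContMDiffVectorBundle ∞ F (CharFiber Ω) 𝓘(ℝ, E)]

omit [ContMDiffVectorBundle ∞ F (CharFiber Ω) 𝓘(ℝ, E)] in
-- The function is the fibrewise pairing of the tautological section of `K^*` with the smooth
-- section `P X` pulled back along `τ`.
theorem contMDiff_momentum {P : ∀ m : M, TangentSpace 𝓘(ℝ, E) m →L[ℝ] CharFiber Ω m}
    (hP : IsConnection F Ω P) {X : ∀ m : M, TangentSpace 𝓘(ℝ, E) m} (hX : SmoothFieldOn X univ) :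
    ContMDiff (dualModel E F) 𝓘(ℝ, ℝ) ∞ (momentum (F := F) P X) := by
  have h1 : ContMDiff 𝓘(ℝ, E) (𝓘(ℝ, E).prod 𝓘(ℝ, F)) ∞
      (fun m : M => (⟨m, P m (X m)⟩ : TotalSpace F (CharFiber Ω))) :=
    hP.smooth.comp (contMDiffOn_univ.1 hX)
  have h2 : ContMDiff (dualModel E F) (𝓘(ℝ, E).prod 𝓘(ℝ, F)) ∞
      (fun ν : DualTotal F Ω => (⟨ν.proj, P ν.proj (X ν.proj)⟩ : TotalSpace F (CharFiber Ω))) :=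
    h1.comp (contMDiff_proj (CharDual Ω))
  have h3 : ContMDiff (dualModel E F) (𝓘(ℝ, E).prod 𝓘(ℝ, F →L[ℝ] ℝ)) ∞
      (fun ν : DualTotal F Ω => TotalSpace.mk' (F →L[ℝ] ℝ) (E := CharDual Ω) ν.proj ν.snd) :=
    contMDiff_id
  have h4 := ContMDiff.clm_bundle_apply (F₁ := F) (F₂ := ℝ) h3 h2
  exact fun ν => (contMDiffAt_totalSpace.1 (h4 ν)).2

theorem interior_thetaP_of_isVerticalLift
    {P : ∀ m : M, TangentSpace 𝓘(ℝ, E) m →L[ℝ] CharFiber Ω m} (hP : IsConnection F Ω P)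
    {U : Set (DualTotal F Ω)} {X : ∀ m : M, TangentSpace 𝓘(ℝ, E) m}
    {Z : ∀ μ : DualTotal F Ω, TangentSpace (dualModel E F) μ} (hZ : IsVerticalLift P U X Z)
    {μ : DualTotal F Ω} (hμ : μ ∈ U) :
    (thetaP P).interior Z μ = DForm.ofFunction (dualModel E F) (momentum P X) μ := by
  ext v
  change μ.snd (P μ.proj (tangentProj μ (Z μ))) = μ.snd (P μ.proj (X μ.proj))
  rw [hZ.proj μ hμ, vertPart, hP.proj]

/-- Cartan's formula turns `L_Z ϑ = 0` into `i_Z d ϑ = -d (i_Z ϑ)`. Since `i_Z ϑ` is known only on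
`U`, openness of `U` is needed to differentiate it. -/
theorem d_thetaP_apply_of_isVerticalLift
    {P : ∀ m : M, TangentSpace 𝓘(ℝ, E) m →L[ℝ] CharFiber Ω m} (hP : IsConnection F Ω P)
    {U : Set (DualTotal F Ω)} (hU : IsOpen U)
    {X : ∀ m : M, TangentSpace 𝓘(ℝ, E) m} (hX : SmoothFieldOn X univ)
    {Z : ∀ μ : DualTotal F Ω, TangentSpace (dualModel E F) μ} (hZ : IsVerticalLift P U X Z)
    {μ : DualTotal F Ω} (hμ : μ ∈ U) (v : Fin 1 → TangentSpace (dualModel E F) μ) :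
    ((thetaP P).d).interior Z μ v =
      - mfderiv (dualModel E F) 𝓘(ℝ, ℝ) (momentum P X) μ (v 0) := by
  have h1 : ((thetaP P).interior Z).d μ =
      (DForm.ofFunction (dualModel E F) (momentum P X)).d μ :=
    DForm.d_congr (by
      filter_upwards [hU.mem_nhds hμ] with ν hν
      exact interior_thetaP_of_isVerticalLift hP hZ hν)
  have h2 := hZ.lie μ hμ
  change ((thetaP P).interior Z).d μ + ((thetaP P).d).interior Z μ = 0 at h2
  rw [eq_neg_of_add_eq_zero_right h2, h1,
    ← DForm.d_ofFunction_apply ((contMDiff_momentum hP hX) μ)]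
  rfl

theorem interior_omegaTilde_eq_d [CompleteSpace E]
    {P : ∀ m : M, TangentSpace 𝓘(ℝ, E) m →L[ℝ] CharFiber Ω m}
    (hK : IsCharBundle F Ω) (hP : IsConnection F Ω P) (hflat : IsFlat P)
    {U : Set (DualTotal F Ω)} (hU : IsOpen U)
    {X : ∀ m : M, TangentSpace 𝓘(ℝ, E) m} (hX : SmoothFieldOn X univ)
    {h : M → ℝ} (hh : ContMDiff 𝓘(ℝ, E) 𝓘(ℝ, ℝ) ∞ h)
    (hXh : ∀ (m : M) (v : TangentSpace 𝓘(ℝ, E) m),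
      Ω m ![X m, v] = mfderiv 𝓘(ℝ, E) 𝓘(ℝ, ℝ) h m v)
    {ZV ZH : ∀ μ : DualTotal F Ω, TangentSpace (dualModel E F) μ}
    (hV : IsVerticalLift P U X ZV) (hH : IsHorizontalLift P U X ZH)
    {μ : DualTotal F Ω} (hμ : μ ∈ U) :
    (omegaTilde P).interior (fun ν => ZV ν + ZH ν) μ =
      (DForm.ofFunction (dualModel E F)
        ((fun ν : DualTotal F Ω => h ν.proj) - momentum P X)).d μ := by
  have hτ : ContMDiff (dualModel E F) 𝓘(ℝ, E) ∞ (fun ν : DualTotal F Ω => ν.proj) :=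
    contMDiff_proj (CharDual Ω)
  have hhτ : ContMDiff (dualModel E F) 𝓘(ℝ, ℝ) ∞ (fun ν : DualTotal F Ω => h ν.proj) := hh.comp hτ
  have hk := contMDiff_momentum (F := F) hP hX
  have hg : ContMDiff (dualModel E F) 𝓘(ℝ, ℝ) ∞
      ((fun ν : DualTotal F Ω => h ν.proj) - momentum P X) := hhτ.sub hk
  ext v
  rw [DForm.d_ofFunction_apply (hg μ), mfderiv_sub
    ((hhτ μ).mdifferentiableAt (by simp)) ((hk μ).mdifferentiableAt (by simp))]
  have e1 : DForm.pullback (I' := dualModel E F) (fun ν : DualTotal F Ω => ν.proj) Ω μ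
      (Matrix.vecCons (ZV μ + ZH μ) v) =
      mfderiv (dualModel E F) 𝓘(ℝ, ℝ) (fun ν : DualTotal F Ω => h ν.proj) μ (v 0) := by
    have hc : mfderiv (dualModel E F) 𝓘(ℝ, ℝ) (fun ν : DualTotal F Ω => h ν.proj) μ =
        mfderiv 𝓘(ℝ, E) 𝓘(ℝ, ℝ) h μ.proj ∘L tangentProj μ :=
      mfderiv_comp μ ((hh μ.proj).mdifferentiableAt (by simp)) ((hτ μ).mdifferentiableAt (by simp))
    have hz : tangentProj μ (ZV μ + ZH μ) = X μ.proj := by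
      rw [(tangentProj μ).map_add, hV.proj μ hμ, hH.proj μ hμ, horPart, add_sub_cancel]
    rw [hc, ContinuousLinearMap.comp_apply, ← hXh, ← hz, DForm.pullback_apply]
    refine congrArg (Ω μ.proj) (funext fun i => ?_)
    fin_cases i <;> rfl
  have e2 : (thetaP P).d μ (Matrix.vecCons (ZV μ + ZH μ) v) =
      ((thetaP P).d).interior ZV μ v + ((thetaP P).d).interior ZH μ v := by
    exact ((thetaP P).d μ).toMultilinearMap.cons_add v (ZV μ) (ZH μ)
  rw [interior_d_thetaP_of_isHorizontalLift hK hP hflat hX hH hμ,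
    d_thetaP_apply_of_isVerticalLift hP hU hX hV hμ] at e2
  exact (congrArg₂ (· + ·) e1 (e2.trans (add_zero _))).trans (sub_eq_add_neg _ _).symm

theorem d_omegaTilde {P : ∀ m : M, TangentSpace 𝓘(ℝ, E) m →L[ℝ] CharFiber Ω m}
    (hP : IsConnection F Ω P) (hΩ : Ω.IsSmooth) (hΩd : Ω.d = 0) (μ : DualTotal F Ω) :
    (omegaTilde P).d μ = 0 := by
  have hτ : ContMDiff (dualModel E F) 𝓘(ℝ, E) ∞ (fun ν : DualTotal F Ω => ν.proj) :=
    contMDiff_proj (CharDual Ω)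
  have hθ := fun ν : DualTotal F Ω => contDiffAt_chartRep_thetaP hP ν
  have hθd : ∀ᶠ ν in 𝓝 μ, DifferentiableAt ℝ ((thetaP P).chartRep ν)
    (extChartAt (dualModel E F) ν ν) := .of_forall fun ν => (hθ ν).differentiableAt (by simp)
  have hθ2 := (hθ μ).of_le (show (2 : WithTop ℕ∞) ≤ ∞ by norm_cast)
  have hΩμ : DifferentiableAt ℝ (Ω.chartRep μ.proj) (extChartAt 𝓘(ℝ, E) μ.proj μ.proj) :=
    ((hΩ μ.proj).contDiffAt (extChartAt_target_mem_nhds μ.proj)).differentiableAt (by simp)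
  rw [omegaTilde, DForm.d_add (DForm.differentiableAt_chartRep_pullback (hτ μ) hΩμ)
    (DForm.differentiableAt_chartRep_d hθd hθ2), DForm.d_d hθd hθ2, add_zero,
    DForm.d_pullback (hτ μ) hΩμ, hΩd]
  rfl

end Lifts

end

/-! ### Invariance of the thickened form. -/

theorem mainTheorem1
    {E : Type*} [NormedAddCommGroup E] [NormedSpace ℝ E] [CompleteSpace E]
    {M : Type*} [TopologicalSpace M] [ChartedSpace E M] [IsManifold 𝓘(ℝ, E) ∞ M]
    -- a closed `2`-form whose kernel is a smooth subbundle of `TM` with typical fibre `F`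
    (Ω : DForm 𝓘(ℝ, E) M 2) (hΩ : Ω.IsSmooth) (hΩd : Ω.d = 0)
    {F : Type*} [NormedAddCommGroup F] [NormedSpace ℝ F]
    [TopologicalSpace (TotalSpace F (CharFiber Ω))]
    [FiberBundle F (CharFiber Ω)] [VectorBundle ℝ F (CharFiber Ω)]
    [ContMDiffVectorBundle ∞ F (CharFiber Ω) 𝓘(ℝ, E)]
    (hK : IsCharBundle F Ω)
    -- a flat connection and a symplectic thickening constructed from it
    (P : ∀ m : M, TangentSpace 𝓘(ℝ, E) m →L[ℝ] CharFiber Ω m)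
    (hP : IsConnection F Ω P) (hflat : IsFlat P)
    (U : Set (DualTotal F Ω)) (hU : IsSymplecticThickening P U)
    -- a vector field `Γ` with `i_Γ Ω = dh`
    (Γ : ∀ m : M, TangentSpace 𝓘(ℝ, E) m) (hΓ : SmoothFieldOn Γ univ)
    (h : M → ℝ) (hh : ContMDiff 𝓘(ℝ, E) 𝓘(ℝ, ℝ) ∞ h)
    (hΓh : ∀ (m : M) (v : TangentSpace 𝓘(ℝ, E) m),
      Ω m ![Γ m, v] = mfderiv 𝓘(ℝ, E) 𝓘(ℝ, ℝ) h m v)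
    -- its lift `ΓV + ΓH`
    (ΓV ΓH : ∀ μ : DualTotal F Ω, TangentSpace (dualModel E F) μ)
    (hV : IsVerticalLift P U Γ ΓV) (hH : IsHorizontalLift P U Γ ΓH) :
    ∀ μ ∈ U, (omegaTilde P).lie (fun ν => ΓV ν + ΓH ν) μ = 0 := by
  intro μ hμ
  -- The contraction is exact on the open set `U`, and `d` is local, so `d ∘ d = 0` applies.
  have h1 : ((omegaTilde P).interior fun ν => ΓV ν + ΓH ν).d μ = 0 := by
    have hg : ContMDiff (dualModel E F) 𝓘(ℝ, ℝ) ∞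
        ((fun ν : DualTotal F Ω => h ν.proj) - momentum P Γ) :=
      (hh.comp (contMDiff_proj (CharDual Ω))).sub (contMDiff_momentum hP hΓ)
    rw [DForm.d_congr (by
      filter_upwards [hU.isOpen.mem_nhds hμ] with ν hν
      exact interior_omegaTilde_eq_d hK hP hflat hU.isOpen hΓ hh hΓh hV hH hν)]
    exact DForm.d_d (.of_forall fun ν =>
      (DForm.contDiffAt_chartRep_ofFunction (hg ν)).differentiableAt (by simp))
      ((DForm.contDiffAt_chartRep_ofFunction (hg μ)).of_le (by norm_cast))
  change _ + ((omegaTilde P).d).interior _ μ = 0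
  rw [h1, zero_add]
  ext v
  rw [DForm.interior_apply, d_omegaTilde hP hΩ hΩd]
  rfl
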